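/- Let $n>1$ and let $w\in\mathfrak S_n$ satisfy $\{w(1),\dots,w(r)\}\ne\{1,\dots,r\}$ for all $1\le r<n$. Let $s_i$ ($1\le i\le n-1$) be the simple reflection transposing $i$ and $i+1$, with products read as compositions, $(uv)(x)=u(v(x))$. Let $\ell(w)$ be the least number of simple reflections with product $w$; a reduced decomposition of $w$ is an expression of $w$ as a product of $\ell(w)$ simple reflections, and a commutation class of $w$ is an equivalence class of reduced decompositions under exchanging adjacent letters $s_i,s_j$ with $|i-j|>1$. Let $X(w)$ be an Elnitsky polygon of $w$: an equilateral $2n$-gon whose sides, read counterclockwise from the topmost vertex, are labelled $1,\dots,n,w(n),\dots,w(1)$, such that the first $n$ sides (the leftside boundary, which descends from the top vertex to the bottom vertex) form half of a convex centrally symmetric $2n$-gon and sides are parallel if and only if they have the same label. The other $n$ sides form the rightside boundary. Let $T(w)$ be the set of rhombic tilings of $X(w)$, i.e. tilings by rhombi whose edges are congruent and parallel to sides of $X(w)$. A tile of a tiling has depth $d$ if a shortest path along tile edges from the top vertex of $X(w)$ to the topmost vertex of the tile has $d-1$ edges. A tile is a left- (resp. right-) perimeter tile if two of its edges are sides of $X(w)$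 on the leftside (resp. rightside) boundary, and a top- (resp. bottom-) perimeter tile if the two sides of $X(w)$ meeting at the top (resp. bottom) vertex are edges of it. Then: (a) For each $1\le d\le n-1$ the following are equivalent: some tiling in $T(w)$ has a left-perimeter tile of depth $d$; $\ell(s_dw)<\ell(w)$; some reduced decomposition of $w$ has $s_d$ as its leftmost letter. (b) For each $1\le d\le n-1$ the following are equivalent: some tiling in $T(w)$ has a right-perimeter tile of depth $d$; $\ell(ws_d)<\ell(w)$; some reduced decomposition of $w$ has $s_d$ as its rightmost letter. (c) Some tiling in $T(w)$ has a top-perimeter tile if and only if there is a commutation class of $w$ in which every reduced decomposition contains exactly one $s_1$. (d) Some tiling in $T(w)$ has a bottom-perimeter tile if and only if there is a commutation class of $w$ in which every reduced decomposition contains exactly one $s_{n-1}$. -/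

import Mathlib

namespace Elnitsky

/-! ### Words in the simple reflections of the symmetric group on `n` letters

Indices are shifted by one: the elements `1, …, n` are `0, …, n - 1 : Fin n`, and the simple
reflections `s_1, …, s_{n-1}` are indexed by `Fin (n - 1)`, with `i` standing for `s_{i+1}`. -/

/-- The simple reflection exchanging the two neighbouring elements `i` and `i + 1`
(in 0-based numbering). -/
def simpleRefl {n : ℕ} (i : Fin (n - 1)) : Equiv.Perm (Fin n) :=
  Equiv.swap ⟨i.val, by omega⟩ ⟨i.val + 1, by omega⟩

/-- The product of the simple reflections spelled by a word, read from left to right.  The product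
of permutations is composition, `(u * v) x = u (v x)`. -/
def wordProd {n : ℕ} (l : List (Fin (n - 1))) : Equiv.Perm (Fin n) :=
  (l.map simpleRefl).prod

/-- The length of `w`: the least number of simple reflections with product `w`. -/
noncomputable def length {n : ℕ} (w : Equiv.Perm (Fin n)) : ℕ :=
  sInf {k : ℕ | ∃ l : List (Fin (n - 1)), wordProd l = w ∧ l.length = k}

/-- The set `R(w)` of reduced decompositions of `w`. -/
def ReducedWord {n : ℕ} (w : Equiv.Perm (Fin n)) : Type :=
  {l : List (Fin (n - 1)) // wordProd l = w ∧ l.length = length w}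

/-- One commutation move: two neighbouring letters `s_i`, `s_j` with `|i - j| > 1` are exchanged. -/
inductive CommMove {n : ℕ} : List (Fin (n - 1)) → List (Fin (n - 1)) → Prop
  | swap (l₁ l₂ : List (Fin (n - 1))) (i j : Fin (n - 1))
      (h : i.val + 1 < j.val ∨ j.val + 1 < i.val) :
      CommMove (l₁ ++ i :: j :: l₂) (l₁ ++ j :: i :: l₂)

/-- Two reduced decompositions are equivalent if a sequence of commutation moves leads from one to
the other. -/
def commSetoid {n : ℕ} (w : Equiv.Perm (Fin n)) : Setoid (ReducedWord w) :=
  Setoid.comap Subtype.val (Relation.EqvGen.setoid (CommMove (n := n)))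

/-- The set `C(w)` of commutation classes of `w`. -/
def CommClass {n : ℕ} (w : Equiv.Perm (Fin n)) : Type :=
  Quotient (commSetoid w)

/-- The reduced decomposition `l` belongs to the commutation class `C`. -/
def ReducedWord.MemClass {n : ℕ} {w : Equiv.Perm (Fin n)} (l : ReducedWord w) (C : CommClass w) :
    Prop :=
  Quotient.mk (commSetoid w) l = C

/-- `{w(1), …, w(r)} ≠ {1, …, r}` whenever `0 < r < n`. -/
def IsContiguous {n : ℕ} (w : Equiv.Perm (Fin n)) : Prop :=
  ∀ r : ℕ, 0 < r → r < n → w '' {i : Fin n | i.val < r} ≠ {i : Fin n | i.val < r}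

/-! ### Elnitsky's polygon in the plane `ℂ` -/

/-- The shape of the left half of the polygon: `dir i` is the side with label `i`, as a vector
pointing downwards.  All sides have length one, and from top to bottom the sides turn strictly
counterclockwise, so that the chain `dir 0, …, dir (n - 1)` is the left half of a
(centrally symmetric) convex `2n`-gon. -/
structure Drawing (n : ℕ) where
  dir : Fin n → ℂ
  norm_dir : ∀ i, ‖dir i‖ = 1
  im_neg : ∀ i, (dir i).im < 0
  turn : ∀ i j, i < j → 0 < (dir i).re * (dir j).im - (dir i).im * (dir j).re

variable {n : ℕ}

/-- The `k`-th vertex (`k = 0, …, n`) of the path that starts in the top vertex `0` and follows the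
sides labelled `u(1), u(2), …, u(n)` downwards. -/
noncomputable def Drawing.vertex (D : Drawing n) (u : Equiv.Perm (Fin n)) (k : ℕ) : ℂ :=
  ∑ i : Fin n with i.val < k, D.dir (u i)

/-- An edge is recorded by its upper endpoint and its label; this is the segment it stands for. -/
def Drawing.edgeSegment (D : Drawing n) (e : ℂ × Fin n) : Set ℂ :=
  segment ℝ e.1 (e.1 + D.dir e.2)

/-- The `k`-th edge, from the top, of the path with labels `u(1), …, u(n)`. -/
noncomputable def Drawing.pathEdge (D : Drawing n) (u : Equiv.Perm (Fin n)) (k : Fin n) :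
    ℂ × Fin n :=
  (D.vertex u k.val, u k)

/-- The edges of the leftside boundary: labels `1, …, n` from top to bottom. -/
noncomputable def Drawing.leftEdge (D : Drawing n) (k : Fin n) : ℂ × Fin n :=
  D.pathEdge 1 k

/-- The edges of the rightside boundary of `X(w)`: labels `w(1), …, w(n)` from top to bottom. -/
noncomputable def Drawing.rightEdge (D : Drawing n) (w : Equiv.Perm (Fin n)) (k : Fin n) :
    ℂ × Fin n :=
  D.pathEdge w k

/-- The leftside boundary as a set of points. -/
def Drawing.leftside (D : Drawing n) : Set ℂ :=
  ⋃ k : Fin n, D.edgeSegment (D.leftEdge k)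

/-- The rightside boundary of `X(w)` as a set of points. -/
def Drawing.rightside (D : Drawing n) (w : Equiv.Perm (Fin n)) : Set ℂ :=
  ⋃ k : Fin n, D.edgeSegment (D.rightEdge w k)

/-- The closed region of Elnitsky's polygon `X(w)`.  Both sides of the boundary descend strictly
from the common top vertex to the common bottom vertex, so the enclosed region consists of the
horizontal segments from a point of the leftside to the point of the rightside at equal height. -/
def Drawing.polygon (D : Drawing n) (w : Equiv.Perm (Fin n)) : Set ℂ :=
  {z | ∃ l ∈ D.leftside, ∃ r ∈ D.rightside w,
    l.im = z.im ∧ r.im = z.im ∧ l.re ≤ z.re ∧ z.re ≤ r.re}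

/-! ### Rhombic tilings -/

/-- A rhombus whose edges are congruent and parallel to the sides labelled `a < b`; it is
determined by these labels and its topmost vertex. -/
structure Tile (n : ℕ) where
  top : ℂ
  a : Fin n
  b : Fin n
  lt : a < b

/-- The closed rhombus covered by a tile. -/
def Tile.region (D : Drawing n) (t : Tile n) : Set ℂ :=
  {z | ∃ x ∈ Set.Icc (0 : ℝ) 1, ∃ y ∈ Set.Icc (0 : ℝ) 1,
    z = t.top + (x : ℂ) * D.dir t.a + (y : ℂ) * D.dir t.b}

/-- The four edges of a tile: upper left, lower left, upper right, lower right. -/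
def Tile.edges (D : Drawing n) (t : Tile n) : Set (ℂ × Fin n) :=
  {(t.top, t.a), (t.top + D.dir t.a, t.b), (t.top, t.b), (t.top + D.dir t.b, t.a)}

/-- The set `T(w)` of rhombic tilings of `X(w)`: finitely many rhombi with edges congruent and
parallel to sides of `X(w)`, with disjoint interiors and with union `X(w)`. -/
structure RhombicTiling (D : Drawing n) (w : Equiv.Perm (Fin n)) where
  tiles : Finset (Tile n)
  disjoint : ∀ s ∈ tiles, ∀ t ∈ tiles, s ≠ t →
    Disjoint (interior (s.region D)) (interior (t.region D))
  cover : ⋃ t ∈ tiles, t.region D = D.polygon w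

/-- The graph in the plane formed by the tile edges of a tiling. -/
def RhombicTiling.graph {D : Drawing n} {w : Equiv.Perm (Fin n)} (T : RhombicTiling D w) :
    SimpleGraph ℂ :=
  SimpleGraph.fromRel fun p q => ∃ t ∈ T.tiles, ∃ i : Fin n, (p, i) ∈ t.edges D ∧ q = p + D.dir i

/-- The tile `t` has depth `d`: a shortest path along tile edges from the top vertex `0` of `X(w)`
to the topmost vertex of `t` has `d - 1` edges. -/
def RhombicTiling.HasDepth {D : Drawing n} {w : Equiv.Perm (Fin n)} (T : RhombicTiling D w)
    (t : Tile n) (d : ℕ) : Prop :=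
  T.graph.edist 0 t.top + 1 = (d : ℕ∞)

/-- A left-perimeter tile includes two edges of the leftside boundary. -/
def Tile.IsLeftPerimeter (D : Drawing n) (t : Tile n) : Prop :=
  ∃ j k : Fin n, j ≠ k ∧ D.leftEdge j ∈ t.edges D ∧ D.leftEdge k ∈ t.edges D

/-- A right-perimeter tile includes two edges of the rightside boundary of `X(w)`. -/
def Tile.IsRightPerimeter (D : Drawing n) (w : Equiv.Perm (Fin n)) (t : Tile n) : Prop :=
  ∃ j k : Fin n, j ≠ k ∧ D.rightEdge w j ∈ t.edges D ∧ D.rightEdge w k ∈ t.edges D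

/-- A top-perimeter tile includes the boundary edges to the left and right of the top vertex. -/
def Tile.IsTopPerimeter (D : Drawing n) (w : Equiv.Perm (Fin n)) (t : Tile n) : Prop :=
  ∃ k : Fin n, k.val = 0 ∧ D.leftEdge k ∈ t.edges D ∧ D.rightEdge w k ∈ t.edges D

/-- A bottom-perimeter tile includes the boundary edges to the left and right of the bottom
vertex. -/
def Tile.IsBottomPerimeter (D : Drawing n) (w : Equiv.Perm (Fin n)) (t : Tile n) : Prop :=
  ∃ k : Fin n, k.val + 1 = n ∧ D.leftEdge k ∈ t.edges D ∧ D.rightEdge w k ∈ t.edges D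

end Elnitsky

/-! Measured by depth below the top vertex, the path with labels `u(1), …, u(n)` is the graph of a
piecewise linear function `D.pos u`, and the polygon is the region between `D.pos 1` and `D.pos w`.
If `u` has an ascent at two neighbouring positions, exchanging them pushes the path to the right
over exactly one rhombus, `D.tileAt u i hi`. A `Sweep` is a chain of such pushes. Each push adds one
inversion, and length counts inversions, so the words of sweeps from `1` to `w` are exactly the
reduced decompositions of `w`.

Every such sweep gives a tiling (`Sweep.exists_tiling`): contiguity forces every letter to occur, so
each boundary edge belongs to a tile. Conversely, every tiling is swept by a reduced word
(`RhombicTiling.exists_sweep`). Some tile has no other tile to its left (`exists_leftmost_tile`); it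
must rest against the current path along two consecutive edges, so it can be removed while the path
moves across it, and induction finishes.

For (a) and (b), the first and the last letter of a word correspond to a tile on the left and on the
right boundary; such a tile may be removed first, which leaves a sweep shorter by one. Its depth is
read off from the number of path edges above a vertex, which is independent of the path
(`Sweep.level_unique`) and changes by one along each tile edge.

For (c), the first label of the path changes only at letters `s_1`, and then increases. A tile at
the top vertex with labels `1` and `w(1)` must therefore be both the first and the last tile swept
there. Case (d) mirrors this at the bottom. Commutation moves preserve letter counts, so the
quantifier over a class reduces to a single reduced word (`exists_commClass_count_iff`). -/

namespace Elnitsky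

variable {n : ℕ}

/-! ### Words in simple reflections -/

section

/-- The upper of the two positions exchanged by a simple reflection. -/
def loPos (i : Fin (n - 1)) : Fin n := ⟨i.val, by omega⟩

/-- The lower of the two positions exchanged by a simple reflection. -/
def hiPos (i : Fin (n - 1)) : Fin n := ⟨i.val + 1, by omega⟩

@[simp] lemma loPos_val (i : Fin (n - 1)) : (loPos i).val = i.val := rfl
@[simp] lemma hiPos_val (i : Fin (n - 1)) : (hiPos i).val = i.val + 1 := rfl

lemma loPos_ne_hiPos (i : Fin (n - 1)) : loPos i ≠ hiPos i := by
  simp [Fin.ext_iff]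

lemma loPos_lt_hiPos (i : Fin (n - 1)) : loPos i < hiPos i := by
  simp [Fin.lt_def]

lemma simpleRefl_eq (i : Fin (n - 1)) : simpleRefl i = Equiv.swap (loPos i) (hiPos i) := rfl

@[simp] lemma simpleRefl_loPos (i : Fin (n - 1)) : simpleRefl i (loPos i) = hiPos i :=
  Equiv.swap_apply_left _ _

@[simp] lemma simpleRefl_hiPos (i : Fin (n - 1)) : simpleRefl i (hiPos i) = loPos i :=
  Equiv.swap_apply_right _ _

lemma simpleRefl_of_ne {i : Fin (n - 1)} {p : Fin n} (h₁ : p ≠ loPos i) (h₂ : p ≠ hiPos i) :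
    simpleRefl i p = p :=
  Equiv.swap_apply_of_ne_of_ne h₁ h₂

@[simp] lemma simpleRefl_mul_self (i : Fin (n - 1)) : simpleRefl i * simpleRefl i = 1 :=
  Equiv.swap_mul_self _ _

@[simp] lemma simpleRefl_simpleRefl (i : Fin (n - 1)) (p : Fin n) :
    simpleRefl i (simpleRefl i p) = p := by
  rw [← Equiv.Perm.mul_apply, simpleRefl_mul_self, Equiv.Perm.one_apply]

@[simp] lemma mul_simpleRefl_cancel (u : Equiv.Perm (Fin n)) (i : Fin (n - 1)) :
    u * simpleRefl i * simpleRefl i = u := by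
  simp [mul_assoc]

@[simp] lemma wordProd_nil : wordProd ([] : List (Fin (n - 1))) = 1 := rfl

@[simp] lemma wordProd_cons (i : Fin (n - 1)) (l : List (Fin (n - 1))) :
    wordProd (i :: l) = simpleRefl i * wordProd l := by
  simp [wordProd]

@[simp] lemma wordProd_append (l l' : List (Fin (n - 1))) :
    wordProd (l ++ l') = wordProd l * wordProd l' := by
  simp [wordProd]

lemma simpleRefl_lt_simpleRefl {i : Fin (n - 1)} {p q : Fin n} (h : p < q)
    (hne : ¬(p = loPos i ∧ q = hiPos i)) : simpleRefl i p < simpleRefl i q := by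
  simp only [Fin.ext_iff, loPos_val, hiPos_val, Fin.lt_def] at hne h
  simp only [simpleRefl_eq, Equiv.swap_apply_def, Fin.ext_iff, loPos_val, hiPos_val, Fin.lt_def,
    apply_ite Fin.val]
  split_ifs <;> omega

/-! ### Inversions and length -/

/-- The inversions of a permutation, as pairs of positions. -/
def inversions (u : Equiv.Perm (Fin n)) : Finset (Fin n × Fin n) :=
  {p | p.1 < p.2 ∧ u p.2 < u p.1}

lemma mem_inversions {u : Equiv.Perm (Fin n)} {p : Fin n × Fin n} :
    p ∈ inversions u ↔ p.1 < p.2 ∧ u p.2 < u p.1 := by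
  simp [inversions]

/-- The exchanged pair of positions is the one new inversion. The others correspond by applying
`simpleRefl i` to both positions, which keeps the order of every other pair. -/
lemma card_inversions_mul_of_lt {u : Equiv.Perm (Fin n)} {i : Fin (n - 1)}
    (h : u (loPos i) < u (hiPos i)) :
    (inversions (u * simpleRefl i)).card = (inversions u).card + 1 := by
  have hmem : (loPos i, hiPos i) ∈ inversions (u * simpleRefl i) := by
    simp [mem_inversions, loPos_lt_hiPos, h]
  rw [← Finset.card_erase_add_one hmem]
  congr 1
  refine Finset.card_nbij' (Prod.map (simpleRefl i) (simpleRefl i))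
    (Prod.map (simpleRefl i) (simpleRefl i)) ?_ ?_ ?_ ?_
  · rintro ⟨p, q⟩ hp
    simp only [Finset.coe_erase, Set.mem_sdiff, Finset.mem_coe, mem_inversions,
      Set.mem_singleton_iff, Prod.mk.injEq, Equiv.Perm.mul_apply] at hp
    simp only [Finset.mem_coe, mem_inversions, Prod.map_apply]
    exact ⟨simpleRefl_lt_simpleRefl hp.1.1 hp.2, hp.1.2⟩
  · rintro ⟨p, q⟩ hp
    simp only [Finset.mem_coe, mem_inversions] at hp
    simp only [Finset.coe_erase, Set.mem_sdiff, Finset.mem_coe, mem_inversions,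
      Set.mem_singleton_iff, Prod.mk.injEq, Equiv.Perm.mul_apply, Prod.map_apply,
      simpleRefl_simpleRefl]
    refine ⟨⟨simpleRefl_lt_simpleRefl hp.1 ?_, hp.2⟩, ?_⟩
    · rintro ⟨rfl, rfl⟩
      exact absurd hp.2 h.not_gt
    · rintro ⟨h₁, h₂⟩
      have h₁' := congrArg (simpleRefl i) h₁
      have h₂' := congrArg (simpleRefl i) h₂
      simp only [simpleRefl_simpleRefl, simpleRefl_loPos, simpleRefl_hiPos] at h₁' h₂'
      rw [h₁', h₂'] at hp
      exact absurd hp.1 (loPos_lt_hiPos i).not_gt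
  · rintro ⟨p, q⟩ _
    simp
  · rintro ⟨p, q⟩ _
    simp

lemma card_inversions_mul_of_gt {u : Equiv.Perm (Fin n)} {i : Fin (n - 1)}
    (h : u (hiPos i) < u (loPos i)) :
    (inversions (u * simpleRefl i)).card + 1 = (inversions u).card := by
  have := card_inversions_mul_of_lt (u := u * simpleRefl i) (i := i) (by simpa using h)
  rw [mul_simpleRefl_cancel] at this
  exact this.symm

lemma lt_or_gt_positions (u : Equiv.Perm (Fin n)) (i : Fin (n - 1)) :
    u (loPos i) < u (hiPos i) ∨ u (hiPos i) < u (loPos i) :=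
  lt_or_gt_of_ne fun h => loPos_ne_hiPos i (u.injective h)

lemma card_inversions_mul_le (u : Equiv.Perm (Fin n)) (i : Fin (n - 1)) :
    (inversions (u * simpleRefl i)).card ≤ (inversions u).card + 1 := by
  rcases lt_or_gt_positions u i with h | h
  · exact (card_inversions_mul_of_lt h).le
  · have := card_inversions_mul_of_gt h
    omega

lemma card_inversions_mul_wordProd_le (l : List (Fin (n - 1))) :
    ∀ u : Equiv.Perm (Fin n),
      (inversions (u * wordProd l)).card ≤ (inversions u).card + l.length := by
  induction l with
  | nil => simp
  | cons i l ih =>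
    intro u
    have h₁ := ih (u * simpleRefl i)
    have h₂ := card_inversions_mul_le u i
    rw [wordProd_cons, ← mul_assoc, List.length_cons]
    omega

lemma inversions_one : inversions (1 : Equiv.Perm (Fin n)) = ∅ := by
  ext p
  simp only [mem_inversions, Equiv.Perm.one_apply, Finset.notMem_empty, iff_false, not_and]
  exact fun h => h.not_gt

lemma perm_eq_one_of_strictMono {u : Equiv.Perm (Fin n)} (h : StrictMono u) : u = 1 := by
  ext x
  have := congrFun (Subsingleton.elim
    (h.orderIsoOfSurjective u u.surjective) (OrderIso.refl (Fin n)) ▸ rfl :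
      ⇑(h.orderIsoOfSurjective u u.surjective) = ⇑(OrderIso.refl (Fin n))) x
  simpa [Fin.ext_iff] using this

lemma exists_descent {u : Equiv.Perm (Fin n)} (h : u ≠ 1) :
    ∃ i : Fin (n - 1), u (hiPos i) < u (loPos i) := by
  by_contra! hu
  apply h
  apply perm_eq_one_of_strictMono
  rcases n with _ | n
  · exact fun x => x.elim0
  · refine Fin.strictMono_iff_lt_succ.2 fun i => ?_
    exact lt_of_le_of_ne (hu i) fun h => loPos_ne_hiPos (n := n + 1) i (u.injective h)

/-- Bubble sort: a permutation other than `1` has a descent, and undoing it removes exactly one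
inversion. -/
lemma exists_word (k : ℕ) : ∀ w : Equiv.Perm (Fin n), (inversions w).card = k →
    ∃ l : List (Fin (n - 1)), wordProd l = w ∧ l.length = k := by
  induction k with
  | zero =>
    intro w hw
    refine ⟨[], ?_, rfl⟩
    by_contra h
    obtain ⟨i, hi⟩ := exists_descent (u := w) (fun h' => h h'.symm)
    have := card_inversions_mul_of_gt hi
    omega
  | succ k ih =>
    intro w hw
    have hne : w ≠ 1 := by
      rintro rfl
      simp [inversions_one] at hw
    obtain ⟨i, hi⟩ := exists_descent hne
    have := card_inversions_mul_of_gt hi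
    obtain ⟨l, hl, hk⟩ := ih (w * simpleRefl i) (by omega)
    exact ⟨l ++ [i], by simp [hl], by simp [hk]⟩

lemma length_eq_card_inversions (w : Equiv.Perm (Fin n)) :
    length w = (inversions w).card := by
  apply le_antisymm
  · exact Nat.sInf_le (exists_word _ w rfl)
  · refine le_csInf ⟨_, exists_word _ w rfl⟩ ?_
    rintro k ⟨l, rfl, rfl⟩
    simpa [inversions_one] using card_inversions_mul_wordProd_le l 1

lemma length_wordProd_le (l : List (Fin (n - 1))) : length (wordProd l) ≤ l.length :=
  Nat.sInf_le ⟨l, rfl, rfl⟩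

lemma exists_reducedWord (w : Equiv.Perm (Fin n)) :
    ∃ l : List (Fin (n - 1)), wordProd l = w ∧ l.length = length w :=
  exists_word _ w (length_eq_card_inversions w).symm

/-- Purely formal: prepending the letter to a shortest word for `simpleRefl i * w` gives a word for
`w` that is short enough to be reduced, and deleting the first letter reverses this. -/
lemma length_simpleRefl_mul_lt_iff (w : Equiv.Perm (Fin n)) (i : Fin (n - 1)) :
    length (simpleRefl i * w) < length w ↔ ∃ l : ReducedWord w, l.val.head? = some i := by
  constructor
  · intro h
    obtain ⟨l, hl, hk⟩ := exists_reducedWord (simpleRefl i * w)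
    have hw : wordProd (i :: l) = w := by
      rw [wordProd_cons, hl, ← mul_assoc, simpleRefl_mul_self, one_mul]
    have := length_wordProd_le (i :: l)
    rw [hw, List.length_cons] at this
    exact ⟨⟨i :: l, hw, by rw [List.length_cons]; omega⟩, rfl⟩
  · rintro ⟨⟨l, hl, hk⟩, h⟩
    rcases l with _ | ⟨j, l⟩
    · simp at h
    · obtain rfl : j = i := by simpa using h
      have := length_wordProd_le l
      rw [← hl, wordProd_cons, ← mul_assoc, simpleRefl_mul_self, one_mul, ← wordProd_cons, hl, ← hk,
        List.length_cons]
      omega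

lemma length_mul_simpleRefl_lt_iff (w : Equiv.Perm (Fin n)) (i : Fin (n - 1)) :
    length (w * simpleRefl i) < length w ↔ ∃ l : ReducedWord w, l.val.getLast? = some i := by
  constructor
  · intro h
    obtain ⟨l, hl, hk⟩ := exists_reducedWord (w * simpleRefl i)
    have hw : wordProd (l ++ [i]) = w := by simp [hl]
    have := length_wordProd_le (l ++ [i])
    rw [hw, List.length_append, List.length_singleton] at this
    exact ⟨⟨l ++ [i], hw, by rw [List.length_append, List.length_singleton]; omega⟩, by simp⟩
  · rintro ⟨⟨l, hl, hk⟩, h⟩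
    obtain ⟨l', rfl⟩ := List.getLast?_eq_some_iff.1 h
    have := length_wordProd_le l'
    have hw : w * simpleRefl i = wordProd l' := by simp [← hl]
    rw [hw, ← hk, List.length_append, List.length_singleton]
    omega

/-! ### Letter counts in commutation classes, and letters forced by contiguity -/

lemma perm_of_eqvGen_commMove {l l' : List (Fin (n - 1))}
    (h : Relation.EqvGen CommMove l l') : l.Perm l' := by
  induction h with
  | rel _ _ h =>
    obtain ⟨l₁, l₂, i, j, _⟩ := h
    exact (List.Perm.swap j i l₂).append_left l₁
  | refl => rfl
  | symm _ _ _ ih => exact ih.symm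
  | trans _ _ _ _ _ ih₁ ih₂ => exact ih₁.trans ih₂

lemma exists_commClass_count_iff (w : Equiv.Perm (Fin n)) (i : Fin (n - 1)) (k : ℕ) :
    (∃ C : CommClass w, ∀ l : ReducedWord w, l.MemClass C → l.val.count i = k) ↔
      ∃ l : ReducedWord w, l.val.count i = k := by
  constructor
  · rintro ⟨C, hC⟩
    obtain ⟨l, rfl⟩ := Quotient.exists_rep C
    exact ⟨l, hC l rfl⟩
  · rintro ⟨l, hl⟩
    refine ⟨Quotient.mk _ l, fun l' h => ?_⟩
    rw [← hl]
    exact (perm_of_eqvGen_commMove (Quotient.exact h)).count_eq i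

/-- If the letter `i` does not occur, the first `i + 1` positions are permuted among themselves. -/
lemma wordProd_le_iff {i : Fin (n - 1)} {l : List (Fin (n - 1))} (h : i ∉ l) (p : Fin n) :
    (wordProd l p).val < i.val + 1 ↔ p.val < i.val + 1 := by
  induction l with
  | nil => simp
  | cons j l ih =>
    simp only [List.mem_cons, not_or] at h
    rw [wordProd_cons, Equiv.Perm.mul_apply, ← ih h.2]
    generalize wordProd l p = q
    have hij : i.val ≠ j.val := fun h' => h.1 (Fin.ext h')
    simp only [simpleRefl_eq, Equiv.swap_apply_def, Fin.ext_iff, loPos_val, hiPos_val,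
      apply_ite Fin.val]
    split_ifs <;> omega

lemma IsContiguous.mem_word {w : Equiv.Perm (Fin n)} (hw : IsContiguous w)
    {l : List (Fin (n - 1))} (hl : wordProd l = w) (i : Fin (n - 1)) : i ∈ l := by
  by_contra h
  apply hw (i.val + 1) (by omega) (by omega)
  ext q
  obtain ⟨p, rfl⟩ := w.surjective q
  subst hl
  simp only [Set.mem_image, EmbeddingLike.apply_eq_iff_eq, exists_eq_right, Set.mem_ofPred_eq]
  exact (wordProd_le_iff h p).symm

end

section

/-! ### Clamped linear functions -/

/-- The part of `[0, x]` that lies in `[0, c]`, as a length. -/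
def clamp (c x : ℝ) : ℝ := max 0 (min c x)

lemma clamp_of_nonpos {c x : ℝ} (h : x ≤ 0) : clamp c x = 0 :=
  max_eq_left ((min_le_right _ _).trans h)

lemma clamp_of_le {c x : ℝ} (hc : 0 ≤ c) (h : c ≤ x) : clamp c x = c := by
  rw [clamp, min_eq_left h, max_eq_right hc]

lemma clamp_of_mem {c x : ℝ} (h₀ : 0 ≤ x) (h : x ≤ c) : clamp c x = x := by
  rw [clamp, min_eq_right h, max_eq_right h₀]

/-- Two consecutive edges together cover the depth range of their concatenation. Applied in both
orders of the edges, this compares a path with its neighbour. -/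
lemma clamp_add {a b : ℝ} (ha : 0 ≤ a) (hb : 0 ≤ b) (x : ℝ) :
    clamp a x + clamp b (x - a) = clamp (a + b) x := by
  rcases le_total x 0 with h | h
  · rw [clamp_of_nonpos h, clamp_of_nonpos h, clamp_of_nonpos (by linarith), add_zero]
  rcases le_total x a with h' | h'
  · rw [clamp_of_mem h h', clamp_of_nonpos (by linarith), clamp_of_mem h (by linarith), add_zero]
  rcases le_total x (a + b) with h'' | h''
  · rw [clamp_of_le ha h', clamp_of_mem (by linarith) (by linarith), clamp_of_mem h h'']
    ring
  · rw [clamp_of_le ha h', clamp_of_le hb (by linarith), clamp_of_le (by linarith) h'']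

@[fun_prop]
lemma continuous_clamp (c : ℝ) : Continuous (clamp c) := by
  unfold clamp
  fun_prop

/-- The difference of two shifted clamped functions, positive exactly on `(0, a + b)`. -/
def bump (a b x : ℝ) : ℝ := clamp b x - clamp b (x - a)

lemma bump_pos {a b x : ℝ} (ha : 0 < a) (hb : 0 < b) (h₀ : 0 < x) (h : x < a + b) :
    0 < bump a b x := by
  have h₁ : 0 < min b x := lt_min hb h₀
  have h₂ : x - a < min b x := lt_min (by linarith) (by linarith)
  rw [bump, sub_pos, clamp, clamp, max_eq_right h₁.le]
  exact max_lt h₁ ((min_le_right _ _).trans_lt h₂)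

lemma bump_of_nonpos {a b x : ℝ} (ha : 0 ≤ a) (h : x ≤ 0) : bump a b x = 0 := by
  rw [bump, clamp_of_nonpos h, clamp_of_nonpos (by linarith), sub_zero]

lemma bump_of_le {a b x : ℝ} (ha : 0 ≤ a) (hb : 0 ≤ b) (h : a + b ≤ x) : bump a b x = 0 := by
  rw [bump, clamp_of_le hb (by linarith), clamp_of_le hb (by linarith), sub_self]

lemma bump_nonneg {a b : ℝ} (ha : 0 < a) (hb : 0 < b) (x : ℝ) : 0 ≤ bump a b x := by
  rcases le_or_gt x 0 with h | h
  · exact (bump_of_nonpos ha.le h).ge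
  rcases lt_or_ge x (a + b) with h' | h'
  · exact (bump_pos ha hb h h').le
  · exact (bump_of_le ha.le hb.le h').ge

lemma bump_eq_zero_iff {a b x : ℝ} (ha : 0 < a) (hb : 0 < b) :
    bump a b x = 0 ↔ x ≤ 0 ∨ a + b ≤ x := by
  constructor
  · intro h
    by_contra! h'
    exact (bump_pos ha hb h'.1 h'.2).ne' h
  · rintro (h | h)
    · exact bump_of_nonpos ha.le h
    · exact bump_of_le ha.le hb.le h

@[fun_prop]
lemma continuous_bump (a b : ℝ) : Continuous (bump a b) := by
  unfold bump
  fun_prop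

/-! ### Partial sums along a permutation -/

lemma sum_lt_succ {M : Type*} [AddCommMonoid M] (f : Fin n → M) (k : Fin n) :
    ∑ i : Fin n with i.val < k.val + 1, f i = ∑ i : Fin n with i.val < k.val, f i + f k := by
  have : (Finset.univ.filter fun i : Fin n => i.val < k.val + 1) =
      insert k (Finset.univ.filter fun i : Fin n => i.val < k.val) := by
    ext i
    simp only [Finset.mem_filter, Finset.mem_univ, true_and, Finset.mem_insert, Fin.ext_iff]
    omega
  rw [this, Finset.sum_insert (by simp), add_comm]

/-- Only the prefix of `i + 1` positions separates the two exchanged ones, so the two paths share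
all vertices except possibly number `i + 1`. -/
lemma sum_lt_mul_simpleRefl {M : Type*} [AddCommMonoid M] (f : Fin n → M)
    (u : Equiv.Perm (Fin n)) (i : Fin (n - 1)) {k : ℕ} (hk : k ≠ i.val + 1) :
    ∑ j : Fin n with j.val < k, f ((u * simpleRefl i) j) = ∑ j : Fin n with j.val < k, f (u j) := by
  refine Finset.sum_equiv (simpleRefl i) (fun j => ?_) (fun j _ => rfl)
  simp only [Finset.mem_filter, Finset.mem_univ, true_and, simpleRefl_eq, Equiv.swap_apply_def,
    Fin.ext_iff, loPos_val, hiPos_val, apply_ite Fin.val]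
  split_ifs <;> omega

/-! ### Heights and slopes -/

/-- The height of the side with a given label. -/
noncomputable def Drawing.drop (D : Drawing n) (i : Fin n) : ℝ := -(D.dir i).im

/-- The horizontal displacement per unit of descent along the side with a given label. -/
noncomputable def Drawing.slope (D : Drawing n) (i : Fin n) : ℝ := (D.dir i).re / D.drop i

/-- The height of the part of a path above its `k`-th vertex. -/
noncomputable def Drawing.vdrop (D : Drawing n) (u : Equiv.Perm (Fin n)) (k : ℕ) : ℝ :=
  ∑ i : Fin n with i.val < k, D.drop (u i)

/-- The height of the polygon. -/
noncomputable def Drawing.height (D : Drawing n) : ℝ := ∑ i, D.drop i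

variable (D : Drawing n)

lemma Drawing.drop_pos (i : Fin n) : 0 < D.drop i := neg_pos.2 (D.im_neg i)

lemma Drawing.slope_mul_drop (i : Fin n) : D.slope i * D.drop i = (D.dir i).re :=
  div_mul_cancel₀ _ (D.drop_pos i).ne'

lemma Drawing.dir_im (i : Fin n) : (D.dir i).im = -D.drop i := (neg_neg _).symm

/-- The turning condition is a cross product; dividing it by the two positive drops compares slopes.
This is how convexity enters the proof. -/
lemma Drawing.slope_strictMono : StrictMono D.slope := by
  intro i j h
  rw [Drawing.slope, Drawing.slope, div_lt_div_iff₀ (D.drop_pos i) (D.drop_pos j)]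
  have := D.turn i j h
  rw [Drawing.drop, Drawing.drop]
  linarith

lemma Drawing.vertex_im (u : Equiv.Perm (Fin n)) (k : ℕ) : (D.vertex u k).im = -D.vdrop u k := by
  simp [Drawing.vertex, Drawing.vdrop, Drawing.drop]

lemma Drawing.vertex_succ (u : Equiv.Perm (Fin n)) (k : Fin n) :
    D.vertex u (k.val + 1) = D.vertex u k.val + D.dir (u k) :=
  sum_lt_succ (fun i => D.dir (u i)) k

lemma Drawing.vdrop_succ (u : Equiv.Perm (Fin n)) (k : Fin n) :
    D.vdrop u (k.val + 1) = D.vdrop u k.val + D.drop (u k) :=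
  sum_lt_succ (fun i => D.drop (u i)) k

@[simp] lemma Drawing.vertex_zero (u : Equiv.Perm (Fin n)) : D.vertex u 0 = 0 := by
  simp [Drawing.vertex]

@[simp] lemma Drawing.vdrop_zero (u : Equiv.Perm (Fin n)) : D.vdrop u 0 = 0 := by
  simp [Drawing.vdrop]

lemma Drawing.vdrop_eq_height (u : Equiv.Perm (Fin n)) : D.vdrop u n = D.height := by
  rw [Drawing.vdrop, Finset.filter_true_of_mem (fun i _ => i.isLt), Drawing.height]
  exact Equiv.sum_comp u _

lemma Drawing.vdrop_mono (u : Equiv.Perm (Fin n)) : Monotone (D.vdrop u) := by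
  intro j k h
  refine Finset.sum_le_sum_of_subset_of_nonneg ?_ fun i _ _ => (D.drop_pos _).le
  intro i
  simp only [Finset.mem_filter, Finset.mem_univ, true_and]
  omega

lemma Drawing.vdrop_lt (u : Equiv.Perm (Fin n)) {j k : ℕ} (h : j < k) (hj : j < n) :
    D.vdrop u j < D.vdrop u k := by
  have h₁ := D.vdrop_succ u ⟨j, hj⟩
  have h₂ := D.drop_pos (u ⟨j, hj⟩)
  have h₃ := D.vdrop_mono u (Nat.succ_le_of_lt h)
  simp only [Nat.succ_eq_add_one] at h₁ h₃
  linarith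

lemma Drawing.vdrop_inj (u : Equiv.Perm (Fin n)) {j k : ℕ} (hj : j ≤ n) (hk : k ≤ n)
    (h : D.vdrop u j = D.vdrop u k) : j = k := by
  rcases lt_trichotomy j k with h' | h' | h'
  · exact absurd h (D.vdrop_lt u h' (by omega)).ne
  · exact h'
  · exact absurd h (D.vdrop_lt u h' (by omega)).ne'

lemma Drawing.vdrop_nonneg (u : Equiv.Perm (Fin n)) (k : ℕ) : 0 ≤ D.vdrop u k :=
  Finset.sum_nonneg fun _ _ => (D.drop_pos _).le

lemma Drawing.vdrop_le_height (u : Equiv.Perm (Fin n)) {k : ℕ} (hk : k ≤ n) :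
    D.vdrop u k ≤ D.height :=
  (D.vdrop_mono u hk).trans (D.vdrop_eq_height u).le

lemma Drawing.vertex_mul_simpleRefl (u : Equiv.Perm (Fin n)) (i : Fin (n - 1)) {k : ℕ}
    (hk : k ≠ i.val + 1) : D.vertex (u * simpleRefl i) k = D.vertex u k :=
  sum_lt_mul_simpleRefl D.dir u i hk

lemma Drawing.vdrop_mul_simpleRefl (u : Equiv.Perm (Fin n)) (i : Fin (n - 1)) {k : ℕ}
    (hk : k ≠ i.val + 1) : D.vdrop (u * simpleRefl i) k = D.vdrop u k :=
  sum_lt_mul_simpleRefl D.drop u i hk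

lemma Drawing.exists_edge (u : Equiv.Perm (Fin n)) {h : ℝ} (h₀ : 0 ≤ h) (k : ℕ) :
    k ≤ n → 0 < k → h ≤ D.vdrop u k →
      ∃ j : Fin n, D.vdrop u j.val ≤ h ∧ h ≤ D.vdrop u (j.val + 1) := by
  induction k with
  | zero => intro _ h; exact absurd h (lt_irrefl 0)
  | succ k ih =>
    intro hk _ hh
    rcases le_total (D.vdrop u k) h with h' | h'
    · exact ⟨⟨k, hk⟩, h', hh⟩
    · rcases Nat.eq_zero_or_pos k with rfl | hpos
      · exact ⟨⟨0, hk⟩, by simpa using h₀, hh⟩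
      · exact ih (by omega) hpos h'

/-! ### Paths as graphs of functions of the height -/

/-- The piecewise linear function of the depth below the top vertex whose slope along the edge with
label `i` is `f i`. -/
noncomputable def Drawing.profile (f : Fin n → ℝ) (u : Equiv.Perm (Fin n)) (h : ℝ) : ℝ :=
  ∑ k : Fin n, f (u k) * clamp (D.drop (u k)) (h - D.vdrop u k.val)

@[fun_prop]
lemma Drawing.continuous_profile (f : Fin n → ℝ) (u : Equiv.Perm (Fin n)) :
    Continuous (D.profile f u) := by
  unfold Drawing.profile
  fun_prop

lemma Drawing.profile_vdrop (f : Fin n → ℝ) (u : Equiv.Perm (Fin n)) (k : ℕ) :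
    D.profile f u (D.vdrop u k) = ∑ i : Fin n with i.val < k, f (u i) * D.drop (u i) := by
  rw [Finset.sum_filter]
  refine Finset.sum_congr rfl fun j _ => ?_
  split_ifs with h
  · have h₁ := D.vdrop_succ u j
    have h₂ := D.vdrop_mono u (Nat.succ_le_of_lt h)
    simp only [Nat.succ_eq_add_one] at h₂
    rw [clamp_of_le (D.drop_pos _).le (by linarith)]
  · have := D.vdrop_mono u (not_lt.1 h)
    rw [clamp_of_nonpos (by linarith), mul_zero]

lemma Drawing.profile_edge (f : Fin n → ℝ) (u : Equiv.Perm (Fin n)) (k : Fin n) {s : ℝ}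
    (h₀ : 0 ≤ s) (hs : s ≤ D.drop (u k)) :
    D.profile f u (D.vdrop u k.val + s) = D.profile f u (D.vdrop u k.val) + f (u k) * s := by
  rw [← sub_eq_iff_eq_add', Drawing.profile, Drawing.profile, ← Finset.sum_sub_distrib,
    Fintype.sum_eq_single k]
  · rw [add_sub_cancel_left, sub_self, clamp_of_mem h₀ hs, clamp_of_nonpos le_rfl]
    ring
  · intro j hj
    rcases lt_or_gt_of_ne hj with h | h
    · have h₁ := D.vdrop_succ u j
      have h₂ := D.vdrop_mono u (Nat.succ_le_of_lt (Fin.lt_def.1 h))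
      simp only [Nat.succ_eq_add_one] at h₂
      rw [clamp_of_le (D.drop_pos _).le (by linarith), clamp_of_le (D.drop_pos _).le (by linarith),
        sub_self]
    · have h₁ := D.vdrop_succ u k
      have h₂ := D.vdrop_mono u (Nat.succ_le_of_lt (Fin.lt_def.1 h))
      simp only [Nat.succ_eq_add_one] at h₂
      rw [clamp_of_nonpos (by linarith), clamp_of_nonpos (by linarith), sub_self]

/-- The function `f` is left general for two uses: with slopes it describes how a path moves, and
with inverse drops how the count of edges above a point changes. Both changes are multiples of the
same bump. -/
lemma Drawing.profile_mul_simpleRefl (f : Fin n → ℝ) (u : Equiv.Perm (Fin n)) (i : Fin (n - 1))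
    (h : ℝ) :
    D.profile f (u * simpleRefl i) h = D.profile f u h +
      (f (u (hiPos i)) - f (u (loPos i))) *
        bump (D.drop (u (loPos i))) (D.drop (u (hiPos i))) (h - D.vdrop u i.val) := by
  rw [← sub_eq_iff_eq_add', Drawing.profile, Drawing.profile, ← Finset.sum_sub_distrib,
    Fintype.sum_eq_add (loPos i) (hiPos i) (loPos_ne_hiPos i)]
  · have h₁ : D.vdrop (u * simpleRefl i) i.val = D.vdrop u i.val :=
      D.vdrop_mul_simpleRefl u i (by omega)
    have h₂ : D.vdrop (u * simpleRefl i) (i.val + 1) =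
        D.vdrop u i.val + D.drop (u (hiPos i)) := by
      have := D.vdrop_succ (u * simpleRefl i) (loPos i)
      rw [loPos_val, h₁] at this
      simpa using this
    have h₃ : D.vdrop u (i.val + 1) = D.vdrop u i.val + D.drop (u (loPos i)) :=
      D.vdrop_succ u (loPos i)
    simp only [Equiv.Perm.mul_apply, simpleRefl_loPos, simpleRefl_hiPos, loPos_val, hiPos_val, h₁,
      h₂, h₃, ← sub_sub]
    -- The two edges, taken in either order, have the same total clamp; the difference of these
    -- identities turns the change of both summands into one multiple of `bump`.
    have e := clamp_add (D.drop_pos (u (loPos i))).le (D.drop_pos (u (hiPos i))).le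
      (h - D.vdrop u i.val)
    have e' := clamp_add (D.drop_pos (u (hiPos i))).le (D.drop_pos (u (loPos i))).le
      (h - D.vdrop u i.val)
    rw [add_comm (D.drop (u (hiPos i)))] at e'
    rw [bump]
    linear_combination f (u (loPos i)) * (e' - e)
  · rintro k ⟨hk₁, hk₂⟩
    have h₂ : k.val ≠ i.val + 1 := fun h => hk₂ (Fin.ext h)
    rw [D.vdrop_mul_simpleRefl u i h₂, Equiv.Perm.mul_apply, simpleRefl_of_ne hk₁ hk₂, sub_self]

/-- The horizontal position of a path at a given depth below the top vertex. -/
noncomputable def Drawing.pos (u : Equiv.Perm (Fin n)) (h : ℝ) : ℝ := D.profile D.slope u h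

@[fun_prop]
lemma Drawing.continuous_pos (u : Equiv.Perm (Fin n)) : Continuous (D.pos u) :=
  D.continuous_profile _ u

lemma Drawing.pos_vdrop (u : Equiv.Perm (Fin n)) (k : ℕ) :
    D.pos u (D.vdrop u k) = (D.vertex u k).re := by
  rw [Drawing.pos, D.profile_vdrop, Drawing.vertex, Complex.re_sum]
  exact Finset.sum_congr rfl fun i _ => D.slope_mul_drop _

lemma Drawing.pos_edge (u : Equiv.Perm (Fin n)) (k : Fin n) {s : ℝ} (h₀ : 0 ≤ s)
    (hs : s ≤ D.drop (u k)) :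
    D.pos u (D.vdrop u k.val + s) = (D.vertex u k.val).re + D.slope (u k) * s := by
  rw [← D.pos_vdrop]
  exact D.profile_edge _ u k h₀ hs

lemma Drawing.pos_mul_simpleRefl (u : Equiv.Perm (Fin n)) (i : Fin (n - 1)) (h : ℝ) :
    D.pos (u * simpleRefl i) h = D.pos u h +
      (D.slope (u (hiPos i)) - D.slope (u (loPos i))) *
        bump (D.drop (u (loPos i))) (D.drop (u (hiPos i))) (h - D.vdrop u i.val) :=
  D.profile_mul_simpleRefl _ u i h

lemma Drawing.pos_le_pos_mul_simpleRefl {u : Equiv.Perm (Fin n)} {i : Fin (n - 1)}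
    (hi : u (loPos i) < u (hiPos i)) (h : ℝ) : D.pos u h ≤ D.pos (u * simpleRefl i) h := by
  rw [D.pos_mul_simpleRefl]
  exact le_add_of_nonneg_right (mul_nonneg (sub_nonneg.2 (D.slope_strictMono hi).le)
    (bump_nonneg (D.drop_pos _) (D.drop_pos _) _))

/-- Translates segments in the plane into graphs over the depth, so that the remaining geometry
becomes inequalities between real functions. -/
lemma Drawing.mem_edgeSegment_pathEdge (u : Equiv.Perm (Fin n)) (k : Fin n) (z : ℂ) :
    z ∈ D.edgeSegment (D.pathEdge u k) ↔
      D.vdrop u k.val ≤ -z.im ∧ -z.im ≤ D.vdrop u (k.val + 1) ∧ z.re = D.pos u (-z.im) := by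
  have hc := D.drop_pos (u k)
  rw [D.vdrop_succ, Drawing.edgeSegment, Drawing.pathEdge, segment_eq_image']
  simp only [add_sub_cancel_left, Set.mem_image, Set.mem_Icc]
  constructor
  · rintro ⟨t, ⟨h₀, h₁⟩, rfl⟩
    have him : -(D.vertex u k.val + t • D.dir (u k)).im = D.vdrop u k.val + t * D.drop (u k) := by
      simp [D.vertex_im, D.dir_im]
      ring
    have h₂ : t * D.drop (u k) ≤ D.drop (u k) := mul_le_of_le_one_left hc.le h₁
    have h₃ : 0 ≤ t * D.drop (u k) := mul_nonneg h₀ hc.le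
    rw [him, D.pos_edge u k h₃ h₂]
    refine ⟨by linarith, by linarith, ?_⟩
    rw [mul_left_comm, D.slope_mul_drop]
    simp
  · rintro ⟨h₁, h₂, h₃⟩
    refine ⟨(-z.im - D.vdrop u k.val) / D.drop (u k), ⟨div_nonneg (by linarith) hc.le,
      (div_le_one hc).2 (by linarith)⟩, ?_⟩
    have := D.pos_edge u k (s := -z.im - D.vdrop u k.val) (by linarith) (by linarith)
    rw [add_sub_cancel] at this
    apply Complex.ext
    · rw [h₃, this]
      simp only [Complex.add_re, Complex.real_smul, Complex.re_ofReal_mul, ← D.slope_mul_drop]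
      field_simp
    · simp only [Complex.add_im, Complex.real_smul, Complex.im_ofReal_mul, D.vertex_im, D.dir_im]
      field_simp
      ring

/-- The closed region between two graphs. -/
def Drawing.between (f g : ℝ → ℝ) : Set ℂ :=
  {z | 0 ≤ -z.im ∧ -z.im ≤ D.height ∧ f (-z.im) ≤ z.re ∧ z.re ≤ g (-z.im)}

lemma Drawing.iUnion_edgeSegment (hn : 0 < n) (u : Equiv.Perm (Fin n)) (z : ℂ) :
    z ∈ ⋃ k : Fin n, D.edgeSegment (D.pathEdge u k) ↔
      0 ≤ -z.im ∧ -z.im ≤ D.height ∧ z.re = D.pos u (-z.im) := by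
  simp only [Set.mem_iUnion, D.mem_edgeSegment_pathEdge]
  constructor
  · rintro ⟨k, h₁, h₂, h₃⟩
    exact ⟨(D.vdrop_nonneg u _).trans h₁, h₂.trans (D.vdrop_le_height u k.isLt), h₃⟩
  · rintro ⟨h₁, h₂, h₃⟩
    obtain ⟨k, hk₁, hk₂⟩ := D.exists_edge u h₁ n le_rfl hn (by rwa [D.vdrop_eq_height])
    exact ⟨k, hk₁, hk₂, h₃⟩

lemma Drawing.polygon_eq (hn : 0 < n) (w : Equiv.Perm (Fin n)) :
    D.polygon w = D.between (D.pos 1) (D.pos w) := by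
  ext z
  simp only [Drawing.polygon, Drawing.between, Set.mem_ofPred_eq, Drawing.leftside,
    Drawing.rightside, Drawing.leftEdge, Drawing.rightEdge, D.iUnion_edgeSegment hn]
  constructor
  · rintro ⟨l, ⟨h₁, h₂, h₃⟩, r, ⟨-, -, h₄⟩, hl, hr, h₅, h₆⟩
    rw [hl] at h₁ h₂ h₃
    rw [hr] at h₄
    exact ⟨h₁, h₂, h₃ ▸ h₅, h₄ ▸ h₆⟩
  · rintro ⟨h₁, h₂, h₃, h₄⟩
    exact ⟨⟨D.pos 1 (-z.im), z.im⟩, ⟨h₁, h₂, rfl⟩, ⟨D.pos w (-z.im), z.im⟩, ⟨h₁, h₂, rfl⟩,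
      rfl, rfl, h₃, h₄⟩

/-! ### Tiles as regions between graphs -/

/-- The depth of the topmost vertex of a tile below the top vertex of the polygon. -/
def Tile.topDrop (t : Tile n) : ℝ := -t.top.im

/-- The depth of the lowest vertex of a tile. -/
noncomputable def Tile.botDrop (t : Tile n) : ℝ := t.topDrop + (D.drop t.a + D.drop t.b)

/-- The left boundary of a tile. -/
noncomputable def Tile.left (t : Tile n) (h : ℝ) : ℝ :=
  t.top.re + D.slope t.a * clamp (D.drop t.a) (h - t.topDrop) +
    D.slope t.b * clamp (D.drop t.b) (h - t.topDrop - D.drop t.a)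

/-- The right boundary of a tile. -/
noncomputable def Tile.right (t : Tile n) (h : ℝ) : ℝ :=
  t.left D h + (D.slope t.b - D.slope t.a) * bump (D.drop t.a) (D.drop t.b) (h - t.topDrop)

/-- The open rhombus of a tile. -/
def Tile.inside (t : Tile n) : Set ℂ :=
  {z | t.topDrop < -z.im ∧ -z.im < t.botDrop D ∧ t.left D (-z.im) < z.re ∧
    z.re < t.right D (-z.im)}

variable {D}

lemma Tile.topDrop_lt_botDrop (t : Tile n) : t.topDrop < t.botDrop D := by
  have h₁ := D.drop_pos t.a
  have h₂ := D.drop_pos t.b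
  rw [Tile.botDrop]
  linarith

lemma Tile.slope_lt (t : Tile n) : D.slope t.a < D.slope t.b := D.slope_strictMono t.lt

@[fun_prop]
lemma Tile.continuous_left (t : Tile n) : Continuous (t.left D) := by
  unfold Tile.left
  fun_prop

@[fun_prop]
lemma Tile.continuous_right (t : Tile n) : Continuous (t.right D) := by
  unfold Tile.right
  fun_prop

lemma Tile.left_lt_right {t : Tile n} {h : ℝ} (h₁ : t.topDrop < h) (h₂ : h < t.botDrop D) :
    t.left D h < t.right D h := by
  rw [Tile.botDrop] at h₂
  exact lt_add_of_pos_right _ (mul_pos (sub_pos.2 t.slope_lt)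
    (bump_pos (D.drop_pos _) (D.drop_pos _) (by linarith) (by linarith)))

lemma Tile.isOpen_inside (t : Tile n) : IsOpen (t.inside D) := by
  refine IsOpen.and ?_ (IsOpen.and ?_ (IsOpen.and ?_ ?_)) <;> refine isOpen_lt ?_ ?_ <;>
    fun_prop (disch := skip)

/-- With the motion along label `a` taken as reference, a point of the tile is given by the depth
`q` gained along label `b`. The left boundary has the least possible `q`, a maximum; the right
boundary in `Tile.right_eq` has the greatest, a minimum. -/
lemma Tile.left_eq (t : Tile n) {h : ℝ} (h₁ : t.topDrop ≤ h) (h₂ : h ≤ t.botDrop D) :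
    t.left D h = t.top.re + D.slope t.a * (h - t.topDrop) +
      (D.slope t.b - D.slope t.a) * max 0 (h - t.topDrop - D.drop t.a) := by
  rw [Tile.botDrop] at h₂
  have e := clamp_add (D.drop_pos t.a).le (D.drop_pos t.b).le (h - t.topDrop)
  rw [clamp_of_mem (c := D.drop t.a + D.drop t.b) (by linarith) (by linarith)] at e
  have e' : clamp (D.drop t.b) (h - t.topDrop - D.drop t.a) =
      max 0 (h - t.topDrop - D.drop t.a) := by
    rw [clamp, min_eq_right (by linarith)]
  rw [Tile.left, ← e']
  linear_combination D.slope t.a * e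

lemma Tile.right_eq (t : Tile n) {h : ℝ} (h₁ : t.topDrop ≤ h) (h₂ : h ≤ t.botDrop D) :
    t.right D h = t.top.re + D.slope t.a * (h - t.topDrop) +
      (D.slope t.b - D.slope t.a) * min (D.drop t.b) (h - t.topDrop) := by
  have hb := D.drop_pos t.b
  rw [Tile.right, t.left_eq h₁ h₂, bump]
  rw [Tile.botDrop] at h₂
  have e : clamp (D.drop t.b) (h - t.topDrop) = min (D.drop t.b) (h - t.topDrop) := by
    rw [clamp, max_eq_right (le_min hb.le (by linarith))]
  have e' : clamp (D.drop t.b) (h - t.topDrop - D.drop t.a) =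
      max 0 (h - t.topDrop - D.drop t.a) := by
    rw [clamp, min_eq_right (by linarith)]
  rw [e, e']
  ring

lemma Tile.param_re (t : Tile n) (x y : ℝ) :
    (t.top + (x : ℂ) * D.dir t.a + (y : ℂ) * D.dir t.b).re =
      t.top.re + D.slope t.a * (x * D.drop t.a) + D.slope t.b * (y * D.drop t.b) := by
  simp only [Complex.add_re, Complex.re_ofReal_mul, ← D.slope_mul_drop]
  ring

lemma Tile.param_im (t : Tile n) (x y : ℝ) :
    -(t.top + (x : ℂ) * D.dir t.a + (y : ℂ) * D.dir t.b).im =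
      t.topDrop + x * D.drop t.a + y * D.drop t.b := by
  simp only [Complex.add_im, Complex.im_ofReal_mul, D.dir_im, Tile.topDrop]
  ring

lemma Tile.mem_region_iff (t : Tile n) (z : ℂ) :
    z ∈ t.region D ↔ t.topDrop ≤ -z.im ∧ -z.im ≤ t.botDrop D ∧ t.left D (-z.im) ≤ z.re ∧
      z.re ≤ t.right D (-z.im) := by
  have ha := D.drop_pos t.a
  have hb := D.drop_pos t.b
  have hm : 0 < D.slope t.b - D.slope t.a := sub_pos.2 t.slope_lt
  constructor
  · rintro ⟨x, ⟨hx₀, hx₁⟩, y, ⟨hy₀, hy₁⟩, rfl⟩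
    have e₁ : 0 ≤ x * D.drop t.a := by positivity
    have e₂ : x * D.drop t.a ≤ D.drop t.a := mul_le_of_le_one_left ha.le hx₁
    have e₃ : 0 ≤ y * D.drop t.b := by positivity
    have e₄ : y * D.drop t.b ≤ D.drop t.b := mul_le_of_le_one_left hb.le hy₁
    rw [t.param_re, t.param_im]
    have r₁ : t.topDrop ≤ t.topDrop + x * D.drop t.a + y * D.drop t.b := by linarith
    have r₂ : t.topDrop + x * D.drop t.a + y * D.drop t.b ≤ t.botDrop D := by
      rw [Tile.botDrop]; linarith
    refine ⟨r₁, r₂, ?_, ?_⟩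
    · rw [t.left_eq r₁ r₂]
      have := mul_le_mul_of_nonneg_left (a := D.slope t.b - D.slope t.a)
        (max_le e₃ (by linarith) : max 0 (t.topDrop + x * D.drop t.a + y * D.drop t.b - t.topDrop -
          D.drop t.a) ≤ y * D.drop t.b) hm.le
      linarith
    · rw [t.right_eq r₁ r₂]
      have := mul_le_mul_of_nonneg_left (a := D.slope t.b - D.slope t.a)
        (le_min e₄ (by linarith) : y * D.drop t.b ≤
          min (D.drop t.b) (t.topDrop + x * D.drop t.a + y * D.drop t.b - t.topDrop)) hm.le
      linarith
  · rintro ⟨h₁, h₂, h₃, h₄⟩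
    rw [t.left_eq h₁ h₂] at h₃
    rw [t.right_eq h₁ h₂] at h₄
    -- Here `q` is the depth gained along label `b`; the remaining depth is gained along `a`. Bounds
    -- on `q` from both boundaries say that both rhombus coordinates lie in `[0, 1]`.
    obtain ⟨q, hq⟩ : ∃ q, q = (z.re - t.top.re - D.slope t.a * (-z.im - t.topDrop)) /
      (D.slope t.b - D.slope t.a) := ⟨_, rfl⟩
    have hq' : z.re = t.top.re + D.slope t.a * (-z.im - t.topDrop) +
        (D.slope t.b - D.slope t.a) * q := by
      rw [hq]
      field_simp
      ring
    rw [hq'] at h₃ h₄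
    have h₅ := le_of_mul_le_mul_left (by linarith : (D.slope t.b - D.slope t.a) *
      max 0 (-z.im - t.topDrop - D.drop t.a) ≤ (D.slope t.b - D.slope t.a) * q) hm
    have h₆ := le_of_mul_le_mul_left (by linarith : (D.slope t.b - D.slope t.a) * q ≤
      (D.slope t.b - D.slope t.a) * min (D.drop t.b) (-z.im - t.topDrop)) hm
    rw [max_le_iff] at h₅
    rw [le_min_iff] at h₆
    refine ⟨(-z.im - t.topDrop - q) / D.drop t.a, ⟨div_nonneg (by linarith) ha.le,
      (div_le_one ha).2 (by linarith)⟩, q / D.drop t.b, ⟨div_nonneg (by linarith) hb.le,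
      (div_le_one hb).2 (by linarith)⟩, ?_⟩
    apply Complex.ext
    · rw [t.param_re, div_mul_cancel₀ _ ha.ne', div_mul_cancel₀ _ hb.ne', hq']
      ring
    · apply neg_injective
      rw [t.param_im, div_mul_cancel₀ _ ha.ne', div_mul_cancel₀ _ hb.ne']
      ring

lemma Tile.inside_subset_region (t : Tile n) : t.inside D ⊆ t.region D := fun z hz =>
  (t.mem_region_iff z).2 ⟨hz.1.le, hz.2.1.le, hz.2.2.1.le, hz.2.2.2.le⟩

lemma Tile.inside_subset_interior (t : Tile n) : t.inside D ⊆ interior (t.region D) :=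
  interior_maximal t.inside_subset_region t.isOpen_inside

lemma Tile.param_mem_inside (t : Tile n) {x y : ℝ} (hx : x ∈ Set.Ioo (0 : ℝ) 1)
    (hy : y ∈ Set.Ioo (0 : ℝ) 1) :
    t.top + (x : ℂ) * D.dir t.a + (y : ℂ) * D.dir t.b ∈ t.inside D := by
  have ha := D.drop_pos t.a
  have hb := D.drop_pos t.b
  have hm : 0 < D.slope t.b - D.slope t.a := sub_pos.2 t.slope_lt
  have e₁ : 0 < x * D.drop t.a := mul_pos hx.1 ha
  have e₂ : x * D.drop t.a < D.drop t.a := mul_lt_of_lt_one_left ha hx.2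
  have e₃ : 0 < y * D.drop t.b := mul_pos hy.1 hb
  have e₄ : y * D.drop t.b < D.drop t.b := mul_lt_of_lt_one_left hb hy.2
  rw [Tile.inside, Set.mem_ofPred_eq, t.param_re, t.param_im]
  have r₁ : t.topDrop < t.topDrop + x * D.drop t.a + y * D.drop t.b := by linarith
  have r₂ : t.topDrop + x * D.drop t.a + y * D.drop t.b < t.botDrop D := by
    rw [Tile.botDrop]; linarith
  refine ⟨r₁, r₂, ?_, ?_⟩
  · rw [t.left_eq r₁.le r₂.le]
    have := mul_lt_mul_of_pos_left
      (max_lt e₃ (by linarith) : max 0 (t.topDrop + x * D.drop t.a + y * D.drop t.b - t.topDrop -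
        D.drop t.a) < y * D.drop t.b) hm
    linarith
  · rw [t.right_eq r₁.le r₂.le]
    have := mul_lt_mul_of_pos_left
      (lt_min e₄ (by linarith) : y * D.drop t.b <
        min (D.drop t.b) (t.topDrop + x * D.drop t.a + y * D.drop t.b - t.topDrop)) hm
    linarith

/-- The closed rhombus is the continuous image of the closed unit square, whose open part is dense.
This lets later arguments move boundary points into the open rhombus. -/
lemma Tile.region_subset_closure_inside (t : Tile n) : t.region D ⊆ closure (t.inside D) := by
  rintro z ⟨x, hx, y, hy, rfl⟩
  have hc : Continuous fun p : ℝ × ℝ => t.top + (p.1 : ℂ) * D.dir t.a + (p.2 : ℂ) * D.dir t.b := by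
    fun_prop
  have hmem : (x, y) ∈ closure (Set.Ioo (0 : ℝ) 1 ×ˢ Set.Ioo (0 : ℝ) 1) := by
    rw [closure_prod_eq, closure_Ioo zero_ne_one]
    exact ⟨hx, hy⟩
  refine closure_mono ?_ (image_closure_subset_closure_image hc ⟨(x, y), hmem, rfl⟩)
  rintro _ ⟨p, hp, rfl⟩
  exact t.param_mem_inside hp.1 hp.2

variable (D)

/-- The tile swept when the path `u` is replaced by `u * simpleRefl i`. -/
noncomputable def Drawing.tileAt (u : Equiv.Perm (Fin n)) (i : Fin (n - 1))
    (h : u (loPos i) < u (hiPos i)) : Tile n :=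
  ⟨D.vertex u i.val, u (loPos i), u (hiPos i), h⟩

/-! ### The tile between two neighbouring paths -/

section tileAt
variable {u : Equiv.Perm (Fin n)} {i : Fin (n - 1)}

lemma Drawing.topDrop_tileAt (hi : u (loPos i) < u (hiPos i)) :
    (D.tileAt u i hi).topDrop = D.vdrop u i.val := by
  rw [Tile.topDrop, Drawing.tileAt, D.vertex_im, neg_neg]

lemma Drawing.botDrop_tileAt (hi : u (loPos i) < u (hiPos i)) :
    (D.tileAt u i hi).botDrop D = D.vdrop u (i.val + 2) := by
  have h₁ := D.vdrop_succ u (loPos i)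
  have h₂ := D.vdrop_succ u (hiPos i)
  rw [loPos_val] at h₁
  rw [hiPos_val, h₁] at h₂
  rw [Tile.botDrop, D.topDrop_tileAt, h₂, ← add_assoc]
  rfl

lemma Drawing.left_tileAt (hi : u (loPos i) < u (hiPos i)) {h : ℝ}
    (h₁ : D.vdrop u i.val ≤ h) (h₂ : h ≤ D.vdrop u (i.val + 2)) :
    (D.tileAt u i hi).left D h = D.pos u h := by
  have ha := D.drop_pos (u (loPos i))
  have hb := D.drop_pos (u (hiPos i))
  have v₁ := D.vdrop_succ u (loPos i)
  have v₂ := D.vdrop_succ u (hiPos i)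
  have w₁ := D.vertex_succ u (loPos i)
  rw [loPos_val] at v₁ w₁
  rw [hiPos_val] at v₂
  rw [Tile.left, D.topDrop_tileAt]
  simp only [Drawing.tileAt]
  rcases le_total h (D.vdrop u (i.val + 1)) with h' | h'
  · have := D.pos_edge u (loPos i) (s := h - D.vdrop u i.val) (by linarith) (by linarith)
    rw [loPos_val, add_sub_cancel] at this
    rw [this, clamp_of_mem (by linarith) (by linarith), clamp_of_nonpos (by linarith)]
    ring
  · have := D.pos_edge u (hiPos i) (s := h - D.vdrop u (i.val + 1)) (by linarith) (by linarith)
    rw [hiPos_val, add_sub_cancel, w₁, v₁, Complex.add_re, ← D.slope_mul_drop] at this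
    rw [this, clamp_of_le ha.le (by linarith), clamp_of_mem (by linarith) (by linarith)]
    ring

lemma Drawing.right_tileAt (hi : u (loPos i) < u (hiPos i)) {h : ℝ}
    (h₁ : D.vdrop u i.val ≤ h) (h₂ : h ≤ D.vdrop u (i.val + 2)) :
    (D.tileAt u i hi).right D h = D.pos (u * simpleRefl i) h := by
  rw [Tile.right, D.left_tileAt hi h₁ h₂, D.topDrop_tileAt, D.pos_mul_simpleRefl]
  rfl

lemma Drawing.pos_lt_pos_mul_simpleRefl_iff (hi : u (loPos i) < u (hiPos i)) {h : ℝ} :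
    D.pos u h < D.pos (u * simpleRefl i) h ↔ D.vdrop u i.val < h ∧ h < D.vdrop u (i.val + 2) := by
  have hm := sub_pos.2 (D.slope_strictMono hi)
  have hb := D.botDrop_tileAt hi
  rw [Tile.botDrop, D.topDrop_tileAt] at hb
  simp only [Drawing.tileAt] at hb
  have h₀ := bump_nonneg (D.drop_pos (u (loPos i))) (D.drop_pos (u (hiPos i))) (h - D.vdrop u i.val)
  rw [D.pos_mul_simpleRefl, lt_add_iff_pos_right, mul_pos_iff_of_pos_left hm, h₀.lt_iff_ne, ne_comm,
    Ne, bump_eq_zero_iff (D.drop_pos _) (D.drop_pos _), ← hb]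
  push Not
  constructor <;> rintro ⟨h₁, h₂⟩ <;> constructor <;> linarith

end tileAt

end

section

variable {D : Drawing n}

/-! ### The left-to-right order of tiles -/

/-- Some horizontal line meets the interiors of both tiles, and meets `s` to the left of `t`. -/
def Tile.LeftOf (D : Drawing n) (s t : Tile n) : Prop :=
  ∃ h, s.topDrop < h ∧ h < s.botDrop D ∧ t.topDrop < h ∧ h < t.botDrop D ∧ s.right D h ≤ t.left D h

lemma Tile.left_le_right (t : Tile n) (h : ℝ) : t.left D h ≤ t.right D h :=
  le_add_of_nonneg_right (mul_nonneg (sub_nonneg.2 t.slope_lt.le)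
    (bump_nonneg (D.drop_pos _) (D.drop_pos _) _))

/-- At a common depth both open rhombi cut out nonempty open intervals; if neither came first, the
intervals would share a point. -/
lemma Tile.right_le_left_or {s t : Tile n} (hd : Disjoint (s.inside D) (t.inside D)) {h : ℝ}
    (h₁ : s.topDrop < h) (h₂ : h < s.botDrop D) (h₃ : t.topDrop < h) (h₄ : h < t.botDrop D) :
    s.right D h ≤ t.left D h ∨ t.right D h ≤ s.left D h := by
  by_contra! hc
  have hs := Tile.left_lt_right h₁ h₂
  have ht := Tile.left_lt_right h₃ h₄
  obtain ⟨x, hx₁, hx₂⟩ := exists_between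
    (max_lt (lt_min hs hc.2) (lt_min hc.1 ht) :
      max (s.left D h) (t.left D h) < min (s.right D h) (t.right D h))
  rw [max_lt_iff] at hx₁
  rw [lt_min_iff] at hx₂
  have hdis : (⟨x, -h⟩ : ℂ) ∈ s.inside D → (⟨x, -h⟩ : ℂ) ∉ t.inside D :=
    fun h => Set.disjoint_left.1 hd h
  refine hdis ?_ ?_
  · simp only [Tile.inside, Set.mem_ofPred_eq, neg_neg]
    exact ⟨h₁, h₂, hx₁.1, hx₂.1⟩
  · simp only [Tile.inside, Set.mem_ofPred_eq, neg_neg]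
    exact ⟨h₃, h₄, hx₁.2, hx₂.2⟩

/-- The order cannot switch: the common depth range is connected and covered by the two closed
conditions, so a switch would make both hold at one depth, where `s` would have no width. -/
lemma Tile.LeftOf.right_le_left {s t : Tile n} (hst : s.LeftOf D t)
    (hd : Disjoint (s.inside D) (t.inside D)) {h : ℝ}
    (h₁ : s.topDrop < h) (h₂ : h < s.botDrop D) (h₃ : t.topDrop < h) (h₄ : h < t.botDrop D) :
    s.right D h ≤ t.left D h := by
  refine (Tile.right_le_left_or hd h₁ h₂ h₃ h₄).resolve_right fun hts => ?_
  obtain ⟨h', h₁', h₂', h₃', h₄', hst'⟩ := hst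
  have hpre : IsPreconnected
      (Set.Ioo (max s.topDrop t.topDrop) (min (s.botDrop D) (t.botDrop D))) :=
    isPreconnected_Ioo
  obtain ⟨x, hx, hx₁, hx₂⟩ := isPreconnected_closed_iff.1 hpre
    {x | s.right D x ≤ t.left D x} {x | t.right D x ≤ s.left D x}
    (isClosed_le (by fun_prop) (by fun_prop)) (isClosed_le (by fun_prop) (by fun_prop))
    (fun x hx => Tile.right_le_left_or hd ((le_max_left _ _).trans_lt hx.1)
      (hx.2.trans_le (min_le_left _ _)) ((le_max_right _ _).trans_lt hx.1)
      (hx.2.trans_le (min_le_right _ _)))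
    ⟨h', ⟨max_lt h₁' h₃', lt_min h₂' h₄'⟩, hst'⟩ ⟨h, ⟨max_lt h₁ h₃, lt_min h₂ h₄⟩, hts⟩
  have e₁ := Tile.left_lt_right (D := D) ((le_max_left _ _).trans_lt hx.1)
    (hx.2.trans_le (min_le_left _ _))
  have e₂ := Tile.left_le_right (D := D) t x
  simp only [Set.mem_ofPred_eq] at hx₁ hx₂
  linarith

/-- Among finitely many tiles with disjoint interiors there is one that can be moved to the left
without hitting another one. -/
lemma exists_leftmost_tile (k : ℕ) : ∀ S : Finset (Tile n), S.card = k → S.Nonempty →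
    (∀ s ∈ S, ∀ t ∈ S, s ≠ t → Disjoint (s.inside D) (t.inside D)) →
    ∃ t ∈ S, ∀ s ∈ S, ¬s.LeftOf D t := by
  classical
  induction k with
  | zero =>
    intro S hS hne
    exact absurd hS hne.card_pos.ne'
  | succ k ih =>
    intro S hS hne hd
    have irrefl : ∀ t : Tile n, ¬t.LeftOf D t := by
      rintro t ⟨h, h₁, h₂, -, -, h₃⟩
      exact h₃.not_gt (Tile.left_lt_right h₁ h₂)
    -- Set aside the tile `m` whose top is lowest and take a leftmost tile `t` of the rest. If `m`
    -- is not left of `t`, then `t` works; otherwise `m` does.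
    obtain ⟨m, hm, hmax⟩ := S.exists_max_image (fun t => t.topDrop) hne
    rcases (S.erase m).eq_empty_or_nonempty with he | he
    · refine ⟨m, hm, fun s hs hsm => ?_⟩
      rcases eq_or_ne s m with rfl | hne
      · exact irrefl _ hsm
      · exact absurd (Finset.mem_erase.2 ⟨hne, hs⟩) (by simp [he])
    · obtain ⟨t, ht, hmin⟩ := ih (S.erase m) (by rw [Finset.card_erase_of_mem hm, hS]; rfl) he
        fun s hs t ht => hd s (Finset.mem_of_mem_erase hs) t (Finset.mem_of_mem_erase ht)
      have htS := Finset.mem_of_mem_erase ht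
      by_cases hmt : m.LeftOf D t
      · refine ⟨m, hm, fun s hs hsm => ?_⟩
        rcases eq_or_ne s m with rfl | hne
        · exact irrefl _ hsm
        have hs' := Finset.mem_erase.2 ⟨hne, hs⟩
        -- Just below the top of `m` all three tiles are present, since no top is lower. There the
        -- order is transitive, so `s` would be left of `t`.
        have hts : m.topDrop < min (m.botDrop D) (min (s.botDrop D) (t.botDrop D)) := by
          obtain ⟨h, -, h₂, h₃, h₄, -⟩ := hsm
          obtain ⟨h', h₁', -, -, h₄', -⟩ := hmt
          exact lt_min m.topDrop_lt_botDrop (lt_min (h₃.trans h₂) (h₁'.trans h₄'))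
        obtain ⟨h, h₁, h₂⟩ := exists_between hts
        simp only [lt_min_iff] at h₂
        have hsh : s.topDrop < h := (hmax s hs).trans_lt h₁
        have hth : t.topDrop < h := (hmax t htS).trans_lt h₁
        have e₁ := hsm.right_le_left (hd s hs m hm hne) hsh h₂.2.1 h₁ h₂.1
        have e₂ := hmt.right_le_left (hd m hm t htS (Finset.ne_of_mem_erase ht).symm) h₁ h₂.1
          hth h₂.2.2
        have e₃ := Tile.left_le_right (D := D) m h
        exact hmin s hs' ⟨h, hsh, h₂.2.1, hth, h₂.2.2, by linarith⟩
      · refine ⟨t, htS, fun s hs => ?_⟩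
        rcases eq_or_ne s m with rfl | hne
        · exact hmt
        · exact hmin s (Finset.mem_erase.2 ⟨hne, hs⟩)

/-! ### Recognizing the edges of a path -/

variable (D)

/-- Over the interval every edge of the path has the slope of `a`, and slopes determine labels;
hence any subinterval inside the height range meets the edge labelled `a`. -/
lemma Drawing.exists_overlap {u : Equiv.Perm (Fin n)} {a : Fin n} {h₀ h₁ x₀ p q : ℝ}
    (hpos : ∀ h, h₀ < h → h < h₁ → D.pos u h = x₀ + D.slope a * h) (hp : h₀ ≤ p) (hq : q ≤ h₁)
    (hpq : p < q) (hp₀ : 0 ≤ p) (hq₀ : q ≤ D.height) :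
    D.vdrop u (u.symm a).val < q ∧ p < D.vdrop u ((u.symm a).val + 1) := by
  obtain ⟨h, hh₁, hh₂⟩ := exists_between hpq
  obtain ⟨j, hj₁, hj₂⟩ := D.exists_edge u (h := h) (by linarith) n le_rfl a.pos
    (by rw [D.vdrop_eq_height]; linarith)
  suffices hja : u j = a by
    have : u.symm a = j := by rw [← hja, Equiv.symm_apply_apply]
    rw [this]
    constructor <;> linarith
  have hj := D.vdrop_lt u (Nat.lt_succ_self j.val) j.isLt
  have hlt : max p (D.vdrop u j.val) < min q (D.vdrop u (j.val + 1)) :=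
    max_lt (lt_min hpq (hh₁.trans_le hj₂)) (lt_min (hj₁.trans_lt hh₂) hj)
  obtain ⟨y, hy₁, hy₂⟩ := exists_between hlt
  obtain ⟨x, hx₁, hx₂⟩ := exists_between hy₁
  rw [max_lt_iff] at hx₁
  rw [lt_min_iff] at hy₂
  have hs := D.vdrop_succ u j
  have ex := D.pos_edge u j (s := x - D.vdrop u j.val) (by linarith) (by linarith)
  have ey := D.pos_edge u j (s := y - D.vdrop u j.val) (by linarith) (by linarith)
  rw [add_sub_cancel, hpos x (by linarith) (by linarith)] at ex
  rw [add_sub_cancel, hpos y (by linarith) (by linarith)] at ey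
  apply D.slope_strictMono.injective
  have : (D.slope (u j) - D.slope a) * (y - x) = 0 := by linear_combination ex - ey
  rcases mul_eq_zero.1 this with h | h <;> linarith

/-- An affine piece as high as the edge `a` must be that edge: if shifted, its overhang would be
disjoint from the edge, against `Drawing.exists_overlap`. -/
lemma Drawing.eq_vdrop_of_affine {u : Equiv.Perm (Fin n)} {a : Fin n} {h₀ x₀ : ℝ}
    (hpos : ∀ h, h₀ < h → h < h₀ + D.drop a → D.pos u h = x₀ + D.slope a * h) (h₁ : 0 ≤ h₀)
    (h₂ : h₀ + D.drop a ≤ D.height) : h₀ = D.vdrop u (u.symm a).val := by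
  have ha := D.drop_pos a
  have hs := D.vdrop_succ u (u.symm a)
  rw [Equiv.apply_symm_apply] at hs
  rcases lt_trichotomy h₀ (D.vdrop u (u.symm a).val) with h | h | h
  · have := D.exists_overlap hpos le_rfl (min_le_right (D.vdrop u (u.symm a).val) (h₀ + D.drop a))
      (lt_min h (by linarith)) h₁ ((min_le_right _ _).trans h₂)
    exact absurd this.1 (min_le_left _ _).not_gt
  · exact h
  · have := D.exists_overlap hpos (le_max_right (D.vdrop u ((u.symm a).val + 1)) h₀) le_rfl
      (max_lt (by linarith) (by linarith)) (h₁.trans (le_max_right _ _)) h₂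
    exact absurd this.2 (le_max_left _ _).not_gt

/-- Each label starts at the same depth on both paths, so both list the labels in the same order and
`w⁻¹ * u` is increasing. -/
lemma Drawing.eq_of_pos_eq {u w : Equiv.Perm (Fin n)}
    (h : ∀ x, 0 < x → x < D.height → D.pos u x = D.pos w x) : u = w := by
  have key : ∀ a, D.vdrop w (w.symm a).val = D.vdrop u (u.symm a).val := by
    intro a
    have h₁ := D.vdrop_nonneg w (w.symm a).val
    have h₂ := D.vdrop_le_height w (w.symm a).isLt
    have hs := D.vdrop_succ w (w.symm a)
    simp only [Nat.succ_eq_add_one] at h₂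
    rw [Equiv.apply_symm_apply] at hs
    refine D.eq_vdrop_of_affine
      (x₀ := (D.vertex w (w.symm a).val).re - D.slope a * D.vdrop w (w.symm a).val) ?_ h₁ (by linarith)
    intro x hx₁ hx₂
    have := D.pos_edge w (w.symm a) (s := x - D.vdrop w (w.symm a).val) (by linarith)
      (by rw [Equiv.apply_symm_apply]; linarith)
    rw [add_sub_cancel, Equiv.apply_symm_apply] at this
    rw [h x (by linarith) (by linarith), this]
    ring
  have hone : w⁻¹ * u = 1 := by
    apply perm_eq_one_of_strictMono
    intro x y hxy
    have h₁ := key (u x)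
    have h₂ := key (u y)
    rw [Equiv.symm_apply_apply] at h₁ h₂
    have := D.vdrop_lt u (Fin.lt_def.1 hxy) x.isLt
    rw [← h₁, ← h₂] at this
    exact lt_of_not_ge fun hle => this.not_ge (D.vdrop_mono w (Fin.le_def.1 hle))
  exact (inv_mul_eq_one.1 hone).symm

lemma Drawing.vertex_inj (u : Equiv.Perm (Fin n)) {j k : ℕ} (hj : j ≤ n) (hk : k ≤ n)
    (h : D.vertex u j = D.vertex u k) : j = k := by
  refine D.vdrop_inj u hj hk ?_
  rw [← neg_inj, ← D.vertex_im, ← D.vertex_im, h]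

/-- The two affine pieces of the left boundary are whole path edges; the second begins where the
first ends, so their positions are consecutive. -/
lemma Drawing.eq_tileAt_of_left_eq {u : Equiv.Perm (Fin n)} {t : Tile n} (h₀ : 0 ≤ t.topDrop)
    (h₁ : t.botDrop D ≤ D.height)
    (h : ∀ x, t.topDrop < x → x < t.botDrop D → t.left D x = D.pos u x) :
    ∃ i, ∃ hi : u (loPos i) < u (hiPos i), t = D.tileAt u i hi := by
  have ha := D.drop_pos t.a
  have hb := D.drop_pos t.b
  have hbot : t.botDrop D = t.topDrop + (D.drop t.a + D.drop t.b) := rfl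
  have ea : t.topDrop = D.vdrop u (u.symm t.a).val := by
    refine D.eq_vdrop_of_affine (x₀ := t.top.re - D.slope t.a * t.topDrop) ?_ h₀ (by linarith)
    intro x hx₁ hx₂
    rw [← h x hx₁ (by linarith), t.left_eq hx₁.le (by linarith), max_eq_left (by linarith)]
    ring
  have eb : t.topDrop + D.drop t.a = D.vdrop u (u.symm t.b).val := by
    refine D.eq_vdrop_of_affine (x₀ := t.top.re - D.slope t.a * t.topDrop -
      (D.slope t.b - D.slope t.a) * (t.topDrop + D.drop t.a)) ?_ (by linarith) (by linarith)
    intro x hx₁ hx₂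
    rw [← h x (by linarith) (by linarith), t.left_eq (by linarith) (by linarith),
      max_eq_right (by linarith)]
    ring
  have hs := D.vdrop_succ u (u.symm t.a)
  rw [Equiv.apply_symm_apply, ← ea, eb] at hs
  have hk := D.vdrop_inj u (u.symm t.a).isLt (u.symm t.b).isLt.le hs
  have hlt := (u.symm t.b).isLt
  have hlo : loPos ⟨(u.symm t.a).val, by omega⟩ = u.symm t.a := rfl
  have hhi : hiPos ⟨(u.symm t.a).val, by omega⟩ = u.symm t.b := Fin.ext hk
  refine ⟨⟨(u.symm t.a).val, by omega⟩, ?_, ?_⟩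
  · rw [hlo, hhi, Equiv.apply_symm_apply, Equiv.apply_symm_apply]
    exact t.lt
  · have htop : t.top = D.vertex u (u.symm t.a).val := by
      -- Agreement is assumed only strictly inside the depth range; continuity extends it to the top
      -- vertex.
      have hcl : t.left D t.topDrop = D.pos u t.topDrop := by
        have hmem : t.topDrop ∈ closure (Set.Ioo t.topDrop (t.botDrop D)) := by
          rw [closure_Ioo t.topDrop_lt_botDrop.ne]
          exact ⟨le_rfl, t.topDrop_lt_botDrop.le⟩
        exact (Set.EqOn.closure (fun x hx => h x hx.1 hx.2 :
          Set.EqOn (t.left D) (D.pos u) (Set.Ioo t.topDrop (t.botDrop D)))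
          t.continuous_left (D.continuous_pos u)) hmem
      rw [t.left_eq le_rfl t.topDrop_lt_botDrop.le, max_eq_left (by linarith), ea, D.pos_vdrop,
        sub_self, mul_zero, mul_zero, add_zero, add_zero] at hcl
      apply Complex.ext hcl
      rw [D.vertex_im, ← ea, Tile.topDrop, neg_neg]
    obtain ⟨top, a, b, hab⟩ := t
    simp only [Drawing.tileAt, Tile.mk.injEq, hlo, hhi, Equiv.apply_symm_apply, and_self,
      and_true]
    exact htop

/-! ### Removing tiles from a tiled region -/

/-- The tiles of `S` have disjoint interiors, and fill the region between two graphs up to its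
degenerate parts. -/
structure TilesBetween (S : Finset (Tile n)) (f g : ℝ → ℝ) : Prop where
  disjoint : ∀ s ∈ S, ∀ t ∈ S, s ≠ t → Disjoint (s.inside D) (t.inside D)
  subset : ∀ s ∈ S, s.region D ⊆ D.between f g
  cover : ∀ z : ℂ, 0 < -z.im → -z.im < D.height → f (-z.im) < z.re → z.re < g (-z.im) →
    ∃ s ∈ S, z ∈ s.region D

variable {D}

lemma Tile.left_mem_region (t : Tile n) {h : ℝ} (h₁ : t.topDrop ≤ h) (h₂ : h ≤ t.botDrop D) :
    (⟨t.left D h, -h⟩ : ℂ) ∈ t.region D := by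
  rw [t.mem_region_iff]
  simp only [neg_neg]
  exact ⟨h₁, h₂, le_rfl, t.left_le_right h⟩

lemma Tile.right_mem_region (t : Tile n) {h : ℝ} (h₁ : t.topDrop ≤ h) (h₂ : h ≤ t.botDrop D) :
    (⟨t.right D h, -h⟩ : ℂ) ∈ t.region D := by
  rw [t.mem_region_iff]
  simp only [neg_neg]
  exact ⟨h₁, h₂, t.left_le_right h, le_rfl⟩

namespace TilesBetween

variable {S : Finset (Tile n)} {f g : ℝ → ℝ}

lemma le_left (hS : TilesBetween D S f g) {t : Tile n} (ht : t ∈ S) {h : ℝ}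
    (h₁ : t.topDrop ≤ h) (h₂ : h ≤ t.botDrop D) : f h ≤ t.left D h := by
  simpa using (hS.subset t ht (t.left_mem_region h₁ h₂)).2.2.1

lemma right_le (hS : TilesBetween D S f g) {t : Tile n} (ht : t ∈ S) {h : ℝ}
    (h₁ : t.topDrop ≤ h) (h₂ : h ≤ t.botDrop D) : t.right D h ≤ g h := by
  simpa using (hS.subset t ht (t.right_mem_region h₁ h₂)).2.2.2

lemma topDrop_nonneg (hS : TilesBetween D S f g) {t : Tile n} (ht : t ∈ S) : 0 ≤ t.topDrop := by
  simpa using (hS.subset t ht (t.left_mem_region le_rfl t.topDrop_lt_botDrop.le)).1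

lemma botDrop_le (hS : TilesBetween D S f g) {t : Tile n} (ht : t ∈ S) :
    t.botDrop D ≤ D.height := by
  simpa using (hS.subset t ht (t.left_mem_region t.topDrop_lt_botDrop.le le_rfl)).2.1

/-- A gap between the left graph and `t` would contain a point of some other tile, and that tile
would be left of `t`. -/
lemma left_eq_of_leftmost (hS : TilesBetween D S f g) (hf : Continuous f) {t : Tile n}
    (ht : t ∈ S) (hmin : ∀ s ∈ S, ¬s.LeftOf D t) {h : ℝ} (h₁ : t.topDrop < h)
    (h₂ : h < t.botDrop D) : t.left D h = f h := by
  classical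
  refine le_antisymm (le_of_not_gt fun hlt => ?_) (hS.le_left ht h₁.le h₂.le)
  have hU : Set.Ioo t.topDrop (t.botDrop D) ∩ {x | f x < t.left D x} ∈ nhds h :=
    (isOpen_Ioo.inter (isOpen_lt hf t.continuous_left)).mem_nhds ⟨⟨h₁, h₂⟩, hlt⟩
  -- The gap persists at nearby depths, so a depth avoiding all tops and bottoms can be chosen; a
  -- tile met there contains that depth strictly in its range.
  obtain ⟨y, ⟨⟨hy₁, hy₂⟩, hy⟩, hyF⟩ := (infinite_of_mem_nhds h hU).exists_notMem_finset
    (S.image (fun s => s.topDrop) ∪ S.image fun s => s.botDrop D)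
  obtain ⟨x, hx₁, hx₂⟩ := exists_between (show f y < t.left D y from hy)
  have htop := hS.topDrop_nonneg ht
  have hbot := hS.botDrop_le ht
  have hlr := Tile.left_lt_right hy₁ hy₂
  have hr := hS.right_le ht hy₁.le hy₂.le
  obtain ⟨s, hs, hsz⟩ := hS.cover ⟨x, -y⟩ (by simp only [neg_neg]; linarith)
    (by simp only [neg_neg]; linarith) (by simpa using hx₁) (by simp only [neg_neg]; linarith)
  rw [s.mem_region_iff] at hsz
  simp only [neg_neg] at hsz
  obtain ⟨z₁, z₂, z₃, z₄⟩ := hsz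
  have hyF' : ∀ s ∈ S, s.topDrop ≠ y ∧ s.botDrop D ≠ y := by
    simp only [Finset.mem_union, Finset.mem_image, not_or, not_exists, not_and] at hyF
    exact fun s hs => ⟨hyF.1 s hs, hyF.2 s hs⟩
  have z₁' := lt_of_le_of_ne z₁ (hyF' s hs).1
  have z₂' := lt_of_le_of_ne z₂ (hyF' s hs).2.symm
  have hne : s ≠ t := by
    rintro rfl
    linarith
  rcases Tile.right_le_left_or (hS.disjoint s hs t ht hne) z₁' z₂' hy₁ hy₂ with h' | h'
  · exact hmin s hs ⟨y, z₁', z₂', hy₁, hy₂, h'⟩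
  · linarith

/-- Stated for moving either boundary, to serve `erase_left` and `erase_right`. The strips cut off
lie inside `t`, so no other tile reaches into them, while `t` misses the new open region. -/
lemma erase [DecidableEq (Tile n)] (hS : TilesBetween D S f g) {t : Tile n} (ht : t ∈ S)
    {f' g' : ℝ → ℝ} (hf' : Continuous f') (hg' : Continuous g') (hf : ∀ h, f h ≤ f' h)
    (hg : ∀ h, g' h ≤ g h)
    (hleft : ∀ z : ℂ, f (-z.im) < z.re → z.re < f' (-z.im) → z ∈ t.inside D)
    (hright : ∀ z : ℂ, g' (-z.im) < z.re → z.re < g (-z.im) → z ∈ t.inside D)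
    (hout : ∀ z : ℂ, f' (-z.im) < z.re → z.re < g' (-z.im) → z ∉ t.region D) :
    TilesBetween D (S.erase t) f' g' where
  disjoint s hs t ht :=
    hS.disjoint s (Finset.mem_of_mem_erase hs) t (Finset.mem_of_mem_erase ht)
  subset s hs z hz := by
    have hs' := Finset.mem_of_mem_erase hs
    have hd := hS.disjoint s hs' t ht (Finset.ne_of_mem_erase hs)
    have hz' := hS.subset s hs' hz
    refine ⟨hz'.1, hz'.2.1, ?_, ?_⟩
    · by_contra! hlt
      have hU : IsOpen {z : ℂ | z.re < f' (-z.im)} := isOpen_lt (by fun_prop) (by fun_prop)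
      obtain ⟨y, hy, hys⟩ := mem_closure_iff.1 (s.region_subset_closure_inside hz) _ hU hlt
      have := hS.le_left hs' hys.1.le hys.2.1.le
      exact Set.disjoint_left.1 hd hys (hleft y (this.trans_lt hys.2.2.1) hy)
    · by_contra! hlt
      have hU : IsOpen {z : ℂ | g' (-z.im) < z.re} := isOpen_lt (by fun_prop) (by fun_prop)
      obtain ⟨y, hy, hys⟩ := mem_closure_iff.1 (s.region_subset_closure_inside hz) _ hU hlt
      have := hS.right_le hs' hys.1.le hys.2.1.le
      exact Set.disjoint_left.1 hd hys (hright y hy (hys.2.2.2.trans_le this))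
  cover z h₀ h₁ hz hz' := by
    obtain ⟨s, hs, hzs⟩ := hS.cover z h₀ h₁ ((hf _).trans_lt hz) (hz'.trans_le (hg _))
    refine ⟨s, Finset.mem_erase.2 ⟨?_, hs⟩, hzs⟩
    rintro rfl
    exact hout z hz hz' hzs

variable {u w : Equiv.Perm (Fin n)} {i : Fin (n - 1)}

lemma mem_inside_tileAt (hi : u (loPos i) < u (hiPos i)) {z : ℂ} (h₁ : D.pos u (-z.im) < z.re)
    (h₂ : z.re < D.pos (u * simpleRefl i) (-z.im)) : z ∈ (D.tileAt u i hi).inside D := by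
  obtain ⟨h₃, h₄⟩ := (D.pos_lt_pos_mul_simpleRefl_iff hi).1 (h₁.trans h₂)
  refine ⟨?_, ?_, ?_, ?_⟩
  · rwa [D.topDrop_tileAt]
  · rwa [D.botDrop_tileAt]
  · rwa [D.left_tileAt hi h₃.le h₄.le]
  · rwa [D.right_tileAt hi h₃.le h₄.le]

lemma mem_region_tileAt_iff (hi : u (loPos i) < u (hiPos i)) {z : ℂ} :
    z ∈ (D.tileAt u i hi).region D ↔ D.vdrop u i.val ≤ -z.im ∧ -z.im ≤ D.vdrop u (i.val + 2) ∧
      D.pos u (-z.im) ≤ z.re ∧ z.re ≤ D.pos (u * simpleRefl i) (-z.im) := by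
  rw [Tile.mem_region_iff, D.topDrop_tileAt, D.botDrop_tileAt]
  constructor
  · rintro ⟨h₁, h₂, h₃, h₄⟩
    rw [D.left_tileAt hi h₁ h₂] at h₃
    rw [D.right_tileAt hi h₁ h₂] at h₄
    exact ⟨h₁, h₂, h₃, h₄⟩
  · rintro ⟨h₁, h₂, h₃, h₄⟩
    rw [D.left_tileAt hi h₁ h₂, D.right_tileAt hi h₁ h₂]
    exact ⟨h₁, h₂, h₃, h₄⟩

lemma erase_left [DecidableEq (Tile n)] (hS : TilesBetween D S (D.pos u) (D.pos w))
    (hi : u (loPos i) < u (hiPos i)) (ht : D.tileAt u i hi ∈ S) :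
    TilesBetween D (S.erase (D.tileAt u i hi)) (D.pos (u * simpleRefl i)) (D.pos w) := by
  refine hS.erase ht (D.continuous_pos _) (D.continuous_pos _) (D.pos_le_pos_mul_simpleRefl hi)
    (fun _ => le_rfl) (fun z => mem_inside_tileAt hi) (fun z h₁ h₂ => absurd h₁ h₂.not_gt) ?_
  intro z h₁ _ hz
  exact ((mem_region_tileAt_iff hi).1 hz).2.2.2.not_gt h₁

lemma erase_right [DecidableEq (Tile n)]
    (hS : TilesBetween D S (D.pos u) (D.pos (w * simpleRefl i)))
    (hi : w (loPos i) < w (hiPos i)) (ht : D.tileAt w i hi ∈ S) :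
    TilesBetween D (S.erase (D.tileAt w i hi)) (D.pos u) (D.pos w) := by
  refine hS.erase ht (D.continuous_pos _) (D.continuous_pos _) (fun _ => le_rfl)
    (D.pos_le_pos_mul_simpleRefl hi) (fun z h₁ h₂ => absurd h₁ h₂.not_gt)
    (fun z => mem_inside_tileAt hi) ?_
  intro z _ h₁ hz
  exact ((mem_region_tileAt_iff hi).1 hz).2.2.1.not_gt h₁

lemma exists_tileAt (hS : TilesBetween D S (D.pos u) (D.pos w)) (hne : S.Nonempty) :
    ∃ i, ∃ hi : u (loPos i) < u (hiPos i), D.tileAt u i hi ∈ S := by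
  obtain ⟨t, ht, hmin⟩ := exists_leftmost_tile (D := D) _ S rfl hne hS.disjoint
  obtain ⟨i, hi, rfl⟩ := D.eq_tileAt_of_left_eq (u := u) (hS.topDrop_nonneg ht) (hS.botDrop_le ht)
    fun x h₁ h₂ => hS.left_eq_of_leftmost (D.continuous_pos u) ht hmin h₁ h₂
  exact ⟨i, hi, ht⟩

lemma pos_le (hS : TilesBetween D S (D.pos u) (D.pos w)) (hi : u (loPos i) < u (hiPos i))
    (ht : D.tileAt u i hi ∈ S)
    (hle : ∀ h, 0 ≤ h → h ≤ D.height → D.pos u h ≤ D.pos w h) (h : ℝ) (h₀ : 0 ≤ h)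
    (h₁ : h ≤ D.height) : D.pos (u * simpleRefl i) h ≤ D.pos w h := by
  by_cases h' : D.pos u h < D.pos (u * simpleRefl i) h
  · obtain ⟨h₂, h₃⟩ := (D.pos_lt_pos_mul_simpleRefl_iff hi).1 h'
    rw [← D.right_tileAt hi h₂.le h₃.le]
    exact hS.right_le ht (by rw [D.topDrop_tileAt]; exact h₂.le)
      (by rw [D.botDrop_tileAt]; exact h₃.le)
  · exact (not_lt.1 h').trans (hle h h₀ h₁)

end TilesBetween

/-! ### Tiles with two edges on a path -/

/-- Each label occurs on an upper and a lower edge of the tile. Two upper edges share their start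
and two lower edges their end, impossible on a path; the other choices form the left or the right
boundary. -/
lemma eq_tileAt_of_two_edges_aux {u : Equiv.Perm (Fin n)} {t : Tile n} {j k : Fin n} (hjk : j ≠ k)
    (hj : D.pathEdge u j ∈ t.edges D) (hk : D.pathEdge u k ∈ t.edges D) (hja : u j = t.a)
    (hkb : u k = t.b) :
    (∃ i, ∃ hi : u (loPos i) < u (hiPos i), t = D.tileAt u i hi) ∨
      ∃ i, ∃ hi : (u * simpleRefl i) (loPos i) < (u * simpleRefl i) (hiPos i),
        t = D.tileAt (u * simpleRefl i) i hi := by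
  have hab := t.lt.ne
  have sj := D.vertex_succ u j
  have sk := D.vertex_succ u k
  rw [hja] at sj
  rw [hkb] at sk
  simp only [Tile.edges, Drawing.pathEdge, hja, hkb, Set.mem_insert_iff, Set.mem_singleton_iff,
    Prod.mk.injEq, and_true, hab, hab.symm, and_false, false_or, or_false] at hj hk
  obtain ⟨top, a, b, lt⟩ := t
  simp only at *
  rcases hj with hj | hj <;> rcases hk with hk | hk
  · left
    have h := D.vertex_inj u (j := k.val) (k := j.val + 1) k.isLt.le j.isLt (by rw [hk, sj, hj])
    have hhi : hiPos ⟨j.val, by omega⟩ = k := Fin.ext h.symm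
    have hlo : loPos ⟨j.val, by omega⟩ = j := rfl
    refine ⟨⟨j.val, by omega⟩, ?_, ?_⟩
    · rw [hlo, hhi, hja, hkb]
      exact lt
    · simp only [Drawing.tileAt, Tile.mk.injEq, hlo, hhi, hja, hkb, and_self, and_true]
      exact hj.symm
  · exact absurd (Fin.ext (D.vertex_inj u j.isLt.le k.isLt.le (hj.trans hk.symm))) hjk
  · refine absurd (Fin.ext (Nat.succ_injective
      (D.vertex_inj u j.isLt k.isLt ?_))) hjk
    simp only [Nat.succ_eq_add_one]
    rw [sj, sk, hj, hk]
    ring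
  · right
    have h := D.vertex_inj u (j := j.val) (k := k.val + 1) j.isLt.le k.isLt (by rw [hj, sk, hk])
    obtain ⟨i, hik⟩ : ∃ i : Fin (n - 1), i.val = k.val := ⟨⟨k.val, by omega⟩, rfl⟩
    have hhi : hiPos i = j := Fin.ext (by rw [hiPos_val, h, hik])
    have hlo : loPos i = k := Fin.ext hik
    have ea : (u * simpleRefl i) (loPos i) = a := by
      rw [Equiv.Perm.mul_apply, simpleRefl_loPos, hhi, hja]
    have eb : (u * simpleRefl i) (hiPos i) = b := by
      rw [Equiv.Perm.mul_apply, simpleRefl_hiPos, hlo, hkb]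
    refine ⟨i, by rwa [ea, eb], ?_⟩
    simp only [Drawing.tileAt, Tile.mk.injEq, ea, eb, and_self, and_true]
    rw [D.vertex_mul_simpleRefl u _ (by omega), hik]
    exact hk.symm

lemma eq_tileAt_of_two_edges {u : Equiv.Perm (Fin n)} {t : Tile n} {j k : Fin n} (hjk : j ≠ k)
    (hj : D.pathEdge u j ∈ t.edges D) (hk : D.pathEdge u k ∈ t.edges D) :
    (∃ i, ∃ hi : u (loPos i) < u (hiPos i), t = D.tileAt u i hi) ∨
      ∃ i, ∃ hi : (u * simpleRefl i) (loPos i) < (u * simpleRefl i) (hiPos i),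
        t = D.tileAt (u * simpleRefl i) i hi := by
  have label : ∀ j, D.pathEdge u j ∈ t.edges D → u j = t.a ∨ u j = t.b := by
    intro j hj
    simp only [Tile.edges, Drawing.pathEdge, Set.mem_insert_iff, Set.mem_singleton_iff,
      Prod.mk.injEq] at hj
    tauto
  rcases label j hj with h₁ | h₁ <;> rcases label k hk with h₂ | h₂
  · exact absurd (u.injective (h₁.trans h₂.symm)) hjk
  · exact eq_tileAt_of_two_edges_aux hjk hj hk h₁ h₂
  · exact eq_tileAt_of_two_edges_aux hjk.symm hk hj h₂ h₁
  · exact absurd (u.injective (h₁.trans h₂.symm)) hjk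

end

section

variable {D : Drawing n}

lemma Tile.edgeSegment_subset_region {t : Tile n} {e : ℂ × Fin n} (he : e ∈ t.edges D) :
    D.edgeSegment e ⊆ t.region D := by
  intro z hz
  rw [Drawing.edgeSegment, segment_eq_image'] at hz
  obtain ⟨s, hs, rfl⟩ := hz
  simp only [add_sub_cancel_left, Complex.real_smul]
  have h₀ : (0 : ℝ) ∈ Set.Icc (0 : ℝ) 1 := ⟨le_rfl, zero_le_one⟩
  have h₁ : (1 : ℝ) ∈ Set.Icc (0 : ℝ) 1 := ⟨zero_le_one, le_rfl⟩
  simp only [Tile.edges, Set.mem_insert_iff, Set.mem_singleton_iff] at he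
  rcases he with rfl | rfl | rfl | rfl
  · exact ⟨s, hs, 0, h₀, by push_cast; ring⟩
  · exact ⟨1, h₁, s, hs, by push_cast; ring⟩
  · exact ⟨0, h₀, s, hs, by push_cast; ring⟩
  · exact ⟨s, hs, 1, h₁, by push_cast; ring⟩

/-! ### Sweeps -/

/-- Starting from the path `u` and multiplying on the right by the letters of a word, each time
increasing the length, sweeps a list of tiles and ends in the path `w`. -/
inductive Sweep (D : Drawing n) :
    Equiv.Perm (Fin n) → List (Fin (n - 1)) → List (Tile n) → Equiv.Perm (Fin n) → Prop
  | nil (u : Equiv.Perm (Fin n)) : Sweep D u [] [] u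
  | cons {u w : Equiv.Perm (Fin n)} {i : Fin (n - 1)} {l : List (Fin (n - 1))} {S : List (Tile n)}
      (hi : u (loPos i) < u (hiPos i)) (h : Sweep D (u * simpleRefl i) l S w) :
      Sweep D u (i :: l) (D.tileAt u i hi :: S) w

section tileAtEdges

variable {u : Equiv.Perm (Fin n)} {i : Fin (n - 1)}

lemma pathEdge_mul_simpleRefl {j : Fin n} (h₁ : j ≠ loPos i) (h₂ : j ≠ hiPos i) :
    D.pathEdge (u * simpleRefl i) j = D.pathEdge u j := by
  rw [Drawing.pathEdge, Drawing.pathEdge, Equiv.Perm.mul_apply, simpleRefl_of_ne h₁ h₂,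
    D.vertex_mul_simpleRefl u i fun h => h₂ (Fin.ext h)]

lemma edges_tileAt (hi : u (loPos i) < u (hiPos i)) : (D.tileAt u i hi).edges D =
    {D.pathEdge u (loPos i), D.pathEdge u (hiPos i), D.pathEdge (u * simpleRefl i) (loPos i),
      D.pathEdge (u * simpleRefl i) (hiPos i)} := by
  have h₁ := D.vertex_succ u (loPos i)
  have h₂ := D.vertex_succ (u * simpleRefl i) (loPos i)
  have h₃ : D.vertex (u * simpleRefl i) i.val = D.vertex u i.val :=
    D.vertex_mul_simpleRefl u i (by omega)
  rw [Equiv.Perm.mul_apply, simpleRefl_loPos] at h₂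
  simp only [loPos_val] at h₁ h₂
  simp only [Tile.edges, Drawing.tileAt, Drawing.pathEdge, loPos_val, hiPos_val, h₁, h₂, h₃,
    Equiv.Perm.mul_apply, simpleRefl_loPos, simpleRefl_hiPos]

end tileAtEdges

namespace Sweep

variable {u w : Equiv.Perm (Fin n)} {l : List (Fin (n - 1))} {S : List (Tile n)}

lemma eq_mul (h : Sweep D u l S w) : w = u * wordProd l := by
  induction h with
  | nil => simp
  | cons hi h ih => rw [ih, wordProd_cons, mul_assoc]

lemma card_inversions (h : Sweep D u l S w) :
    (inversions w).card = (inversions u).card + l.length := by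
  induction h with
  | nil => simp
  | cons hi h ih =>
    rw [ih, card_inversions_mul_of_lt hi, List.length_cons]
    omega

lemma pos_le (h : Sweep D u l S w) (x : ℝ) : D.pos u x ≤ D.pos w x := by
  induction h with
  | nil => rfl
  | cons hi h ih => exact (D.pos_le_pos_mul_simpleRefl hi x).trans ih

/-- A letter adds at most one inversion, so a word that adds as many as it has letters cannot start
with a descent. -/
lemma exists_of_card (D : Drawing n) (l : List (Fin (n - 1))) : ∀ u : Equiv.Perm (Fin n),
    (inversions (u * wordProd l)).card = (inversions u).card + l.length →
      ∃ S, Sweep D u l S (u * wordProd l) := by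
  induction l with
  | nil => exact fun u _ => ⟨[], by simpa using Sweep.nil u⟩
  | cons i l ih =>
    intro u hu
    rw [wordProd_cons, ← mul_assoc, List.length_cons] at hu
    have h₁ := card_inversions_mul_wordProd_le l (u * simpleRefl i)
    have hi : u (loPos i) < u (hiPos i) := by
      refine (lt_or_gt_positions u i).resolve_right fun hi => ?_
      have h₂ := card_inversions_mul_of_gt hi
      omega
    have h₂ := card_inversions_mul_of_lt hi
    obtain ⟨S, hS⟩ := ih (u * simpleRefl i) (by omega)
    refine ⟨D.tileAt u i hi :: S, ?_⟩
    rw [wordProd_cons, ← mul_assoc]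
    exact hS.cons hi

lemma exists_of_reduced (D : Drawing n) (hl : wordProd l = w) (hk : l.length = length w) :
    ∃ S, Sweep D 1 l S w := by
  subst hl
  have := exists_of_card D l 1 (by rw [one_mul, inversions_one, hk, length_eq_card_inversions]; simp)
  rwa [one_mul] at this

lemma reduced (h : Sweep D 1 l S w) : wordProd l = w ∧ l.length = length w := by
  have h₁ := h.eq_mul
  have h₂ := h.card_inversions
  rw [one_mul] at h₁
  rw [inversions_one, Finset.card_empty, zero_add] at h₂
  exact ⟨h₁.symm, by rw [length_eq_card_inversions, h₂]⟩

lemma subset_between (h : Sweep D u l S w) {t : Tile n} (ht : t ∈ S) :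
    t.region D ⊆ D.between (D.pos u) (D.pos w) := by
  induction h with
  | nil => simp at ht
  | @cons u w i l S hi h ih =>
    rcases List.mem_cons.1 ht with rfl | ht
    · intro z hz
      obtain ⟨h₁, h₂, h₃, h₄⟩ := (TilesBetween.mem_region_tileAt_iff hi).1 hz
      exact ⟨(D.vdrop_nonneg u _).trans h₁, h₂.trans (D.vdrop_le_height u (by omega)), h₃,
        h₄.trans (h.pos_le _)⟩
    · intro z hz
      obtain ⟨h₁, h₂, h₃, h₄⟩ := ih ht hz
      exact ⟨h₁, h₂, (D.pos_le_pos_mul_simpleRefl hi _).trans h₃, h₄⟩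

/-- The first tile lies left of the new path and all later ones right of it. -/
lemma pairwise_disjoint (h : Sweep D u l S w) :
    S.Pairwise fun s t => Disjoint (interior (s.region D)) (interior (t.region D)) := by
  induction h with
  | nil => exact List.Pairwise.nil
  | @cons u w i l S hi h ih =>
    refine List.Pairwise.cons (fun t ht => ?_) ih
    rw [Set.disjoint_left]
    intro z hz hz'
    have hre : ∀ z ∈ (D.tileAt u i hi).region D, z.re ≤ D.pos (u * simpleRefl i) (-z.im) :=
      fun z hz => ((TilesBetween.mem_region_tileAt_iff hi).1 hz).2.2.2
    have h₁ : interior ((D.tileAt u i hi).region D) ∩ t.inside D = ∅ := by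
      rw [Set.eq_empty_iff_forall_notMem]
      rintro y ⟨hy, hy'⟩
      have h₂ := h.subset_between ht (t.left_mem_region hy'.1.le hy'.2.1.le)
      have h₃ := hre y (interior_subset hy)
      have h₄ := hy'.2.2.1
      have h₅ := h₂.2.2.1
      simp only [neg_neg] at h₅
      linarith
    have h₂ := t.region_subset_closure_inside (interior_subset hz')
    obtain ⟨y, hy⟩ := mem_closure_iff.1 h₂ _ isOpen_interior hz
    exact (Set.eq_empty_iff_forall_notMem.1 h₁) y hy

/-- The first alternative is needed where the sweep never moves the starting path. -/
lemma cover (h : Sweep D u l S w) {z : ℂ} (hz : z ∈ D.between (D.pos u) (D.pos w)) :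
    z.re = D.pos u (-z.im) ∨ ∃ t ∈ S, z ∈ t.region D := by
  induction h with
  | nil => exact Or.inl (le_antisymm hz.2.2.2 hz.2.2.1)
  | @cons u w i l S hi h ih =>
    rcases hz.2.2.1.lt_or_eq with hlt | heq
    · right
      rcases lt_or_ge z.re (D.pos (u * simpleRefl i) (-z.im)) with hlt' | hge
      · exact ⟨_, List.mem_cons_self,
          Tile.inside_subset_region _ (TilesBetween.mem_inside_tileAt hi hlt hlt')⟩
      · rcases ih ⟨hz.1, hz.2.1, hge, hz.2.2.2⟩ with heq | ⟨t, ht, hzt⟩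
        · obtain ⟨h₁, h₂⟩ := (D.pos_lt_pos_mul_simpleRefl_iff hi).1 (heq ▸ hlt)
          exact ⟨_, List.mem_cons_self, (TilesBetween.mem_region_tileAt_iff hi).2
            ⟨h₁.le, h₂.le, hlt.le, heq.le⟩⟩
        · exact ⟨t, List.mem_cons_of_mem _ ht, hzt⟩
    · exact Or.inl heq.symm

lemma edges_or (h : Sweep D u l S w) (j : Fin n) :
    ((∃ t ∈ S, D.pathEdge u j ∈ t.edges D) ∧ ∃ t ∈ S, D.pathEdge w j ∈ t.edges D) ∨
      (D.pathEdge w j = D.pathEdge u j ∧ ∀ i ∈ l, j ≠ loPos i ∧ j ≠ hiPos i) := by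
  induction h with
  | nil => right; simp
  | @cons u w i l S hi h ih =>
    by_cases hj : j = loPos i ∨ j = hiPos i
    · left
      have h₁ : D.pathEdge u j ∈ (D.tileAt u i hi).edges D := by
        rw [edges_tileAt]
        rcases hj with rfl | rfl <;> simp
      have h₂ : D.pathEdge (u * simpleRefl i) j ∈ (D.tileAt u i hi).edges D := by
        rw [edges_tileAt]
        rcases hj with rfl | rfl <;> simp
      refine ⟨⟨_, List.mem_cons_self, h₁⟩, ?_⟩
      rcases ih with ⟨-, t, ht, hte⟩ | ⟨he, -⟩
      · exact ⟨t, List.mem_cons_of_mem _ ht, hte⟩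
      · exact ⟨_, List.mem_cons_self, he ▸ h₂⟩
    · rw [not_or] at hj
      rw [pathEdge_mul_simpleRefl hj.1 hj.2] at ih
      rcases ih with ⟨⟨t, ht, hte⟩, t', ht', hte'⟩ | ⟨he, hl⟩
      · exact Or.inl ⟨⟨t, List.mem_cons_of_mem _ ht, hte⟩, t', List.mem_cons_of_mem _ ht', hte'⟩
      · exact Or.inr ⟨he, List.forall_mem_cons.2 ⟨hj, hl⟩⟩

lemma exists_edges (h : Sweep D 1 l S w) (hn : 2 ≤ n) (hw : IsContiguous w) (j : Fin n) :
    (∃ t ∈ S, D.pathEdge 1 j ∈ t.edges D) ∧ ∃ t ∈ S, D.pathEdge w j ∈ t.edges D := by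
  refine (h.edges_or j).resolve_right fun hj => ?_
  have hl := h.reduced.1
  by_cases hjn : j.val < n - 1
  · exact (hj.2 _ (hw.mem_word hl ⟨j.val, hjn⟩)).1 rfl
  -- The last position is never the upper one of an exchange; the last letter moves it as the lower
  -- one.
  · refine (hj.2 _ (hw.mem_word hl ⟨n - 2, by omega⟩)).2 (Fin.ext ?_)
    simp only [hiPos_val]
    omega

/-- The tiles of a sweep from the leftside to the rightside of the polygon form a tiling. -/
lemma exists_tiling (h : Sweep D 1 l S w) (hn : 2 ≤ n) (hw : IsContiguous w) :
    ∃ T : RhombicTiling D w, ∀ t, t ∈ T.tiles ↔ t ∈ S := by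
  classical
  refine ⟨⟨S.toFinset, ?_, ?_⟩, fun t => List.mem_toFinset⟩
  · intro s hs t ht hst
    have : Std.Symm fun s t : Tile n =>
        Disjoint (interior (s.region D)) (interior (t.region D)) := ⟨fun _ _ h => h.symm⟩
    exact h.pairwise_disjoint.forall (List.mem_toFinset.1 hs)
      (List.mem_toFinset.1 ht) hst
  · rw [D.polygon_eq (by omega)]
    apply Set.Subset.antisymm
    · intro z hz
      simp only [Set.mem_iUnion, List.mem_toFinset, exists_prop] at hz
      obtain ⟨t, ht, hzt⟩ := hz
      exact h.subset_between ht hzt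
    · intro z hz
      simp only [Set.mem_iUnion, List.mem_toFinset, exists_prop]
      rcases h.cover hz with heq | ht
      · obtain ⟨k, hk⟩ := Set.mem_iUnion.1
          ((D.iUnion_edgeSegment (by omega) 1 z).2 ⟨hz.1, hz.2.1, heq⟩)
        obtain ⟨t, ht, hte⟩ := (h.exists_edges hn hw k).1
        exact ⟨t, ht, Tile.edgeSegment_subset_region hte hk⟩
      · exact ht

lemma exists_last {l' : List (Fin (n - 1))} {i : Fin (n - 1)} (h : Sweep D u l S w)
    (hl : l = l' ++ [i]) :
    ∃ hi : (w * simpleRefl i) (loPos i) < (w * simpleRefl i) (hiPos i),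
      D.tileAt (w * simpleRefl i) i hi ∈ S := by
  induction h generalizing l' with
  | nil => simp at hl
  | @cons u w j l S hj h ih =>
    rcases l' with _ | ⟨k, l'⟩
    · obtain ⟨rfl, rfl⟩ : j = i ∧ l = [] := by simpa using hl
      have hw := h.eq_mul
      rw [wordProd_nil, mul_one] at hw
      have hu : w * simpleRefl j = u := by rw [hw, mul_simpleRefl_cancel]
      refine ⟨by rwa [hu], ?_⟩
      simp only [hu]
      exact List.mem_cons_self
    · obtain ⟨-, rfl⟩ : j = k ∧ l = l' ++ [i] := by simpa using hl
      obtain ⟨hi, hmem⟩ := ih rfl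
      exact ⟨hi, List.mem_cons_of_mem _ hmem⟩

end Sweep

/-! ### From tilings to sweeps -/

lemma RhombicTiling.tilesBetween {w : Equiv.Perm (Fin n)} (hn : 0 < n) (T : RhombicTiling D w) :
    TilesBetween D T.tiles (D.pos 1) (D.pos w) where
  disjoint s hs t ht hst := (T.disjoint s hs t ht hst).mono s.inside_subset_interior
    t.inside_subset_interior
  subset s hs z hz := by
    rw [← D.polygon_eq hn, ← T.cover]
    exact Set.mem_biUnion hs hz
  cover z h₀ h₁ hz hz' := by
    have : z ∈ D.polygon w := by
      rw [D.polygon_eq hn]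
      exact ⟨h₀.le, h₁.le, hz.le, hz'.le⟩
    rw [← T.cover] at this
    simpa only [Set.mem_iUnion, exists_prop] using this

lemma pos_one_le_pos (D : Drawing n) (w : Equiv.Perm (Fin n)) (h : ℝ) :
    D.pos 1 h ≤ D.pos w h := by
  obtain ⟨l, hl, hk⟩ := exists_reducedWord w
  obtain ⟨S, hS⟩ := Sweep.exists_of_reduced D hl hk
  exact hS.pos_le h

/-- Every tiling of the region between two paths can be swept from left to right. -/
lemma TilesBetween.exists_sweep {w : Equiv.Perm (Fin n)} (k : ℕ) :
    ∀ (S : Finset (Tile n)) (u : Equiv.Perm (Fin n)), S.card = k →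
      TilesBetween D S (D.pos u) (D.pos w) →
      (∀ h, 0 ≤ h → h ≤ D.height → D.pos u h ≤ D.pos w h) →
      ∃ l L, Sweep D u l L w ∧ ∀ t, t ∈ L ↔ t ∈ S := by
  classical
  induction k with
  | zero =>
    intro S u hS hT hle
    obtain rfl := Finset.card_eq_zero.1 hS
    -- With no tiles left there is no room between the paths, so their graphs, and hence the
    -- permutations, agree.
    obtain rfl : u = w := D.eq_of_pos_eq fun x h₀ h₁ => by
      refine le_antisymm (hle x h₀.le h₁.le) (le_of_not_gt fun hlt => ?_)
      obtain ⟨y, hy₁, hy₂⟩ := exists_between hlt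
      obtain ⟨s, hs, -⟩ := hT.cover ⟨y, -x⟩ (by simpa using h₀) (by simpa using h₁)
        (by simpa using hy₁) (by simpa using hy₂)
      exact absurd hs (Finset.notMem_empty s)
    exact ⟨[], [], Sweep.nil u, by simp⟩
  | succ k ih =>
    intro S u hS hT hle
    obtain ⟨i, hi, ht⟩ := hT.exists_tileAt (Finset.card_pos.1 (by omega))
    obtain ⟨l, L, hL, hmem⟩ := ih (S.erase (D.tileAt u i hi)) (u * simpleRefl i)
      (by rw [Finset.card_erase_of_mem ht, hS]; rfl) (hT.erase_left hi ht) (hT.pos_le hi ht hle)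
    refine ⟨i :: l, D.tileAt u i hi :: L, hL.cons hi, fun t => ?_⟩
    rw [List.mem_cons, hmem, Finset.mem_erase]
    by_cases h : t = D.tileAt u i hi
    · simp [h, ht]
    · simp [h]

lemma RhombicTiling.exists_sweep {w : Equiv.Perm (Fin n)} (hn : 0 < n) (T : RhombicTiling D w) :
    ∃ l L, Sweep D 1 l L w ∧ ∀ t, t ∈ L ↔ t ∈ T.tiles :=
  TilesBetween.exists_sweep _ T.tiles 1 rfl (T.tilesBetween hn) fun h _ _ => pos_one_le_pos D w h

/-! ### Depth -/

/-- The point `z` is the `k`-th vertex of one of the paths that are visited when the word `l` is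
applied to the path `u`. -/
inductive Level (D : Drawing n) :
    Equiv.Perm (Fin n) → List (Fin (n - 1)) → ℂ → ℕ → Prop
  | here (u : Equiv.Perm (Fin n)) (l : List (Fin (n - 1))) {k : ℕ} (hk : k ≤ n) :
      Level D u l (D.vertex u k) k
  | next {u : Equiv.Perm (Fin n)} {i : Fin (n - 1)} {l : List (Fin (n - 1))} {z : ℂ} {k : ℕ}
      (h : Level D (u * simpleRefl i) l z k) : Level D u (i :: l) z k

lemma card_filter_val_lt {k : ℕ} (hk : k ≤ n) :
    (Finset.univ.filter fun i : Fin n => i.val < k).card = k := by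
  rw [Fin.card_filter_val_lt, min_eq_right hk]

/-- With weight one over its drop, every edge contributes one, so the profile counts the edges above
a vertex. -/
lemma Drawing.profile_inv_drop (D : Drawing n) (u : Equiv.Perm (Fin n)) {k : ℕ} (hk : k ≤ n) :
    D.profile (fun i => (D.drop i)⁻¹) u (D.vdrop u k) = k := by
  rw [D.profile_vdrop, Finset.sum_congr rfl fun i _ => inv_mul_cancel₀ (D.drop_pos (u i)).ne']
  simp [card_filter_val_lt hk]

namespace Sweep

variable {u w : Equiv.Perm (Fin n)} {l : List (Fin (n - 1))} {S : List (Tile n)}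

lemma pos_le_of_level (h : Sweep D u l S w) {z : ℂ} {k : ℕ} (hz : Level D u l z k) :
    D.pos u (-z.im) ≤ z.re := by
  induction h with
  | nil u =>
    cases hz with
    | here _ _ hk => rw [D.vertex_im, neg_neg, D.pos_vdrop]
  | cons hi h ih =>
    cases hz with
    | here _ _ hk => rw [D.vertex_im, neg_neg, D.pos_vdrop]
    | next hz => exact (D.pos_le_pos_mul_simpleRefl hi _).trans (ih hz)

/-- If a vertex of a later path still lies on `u`, the intermediate moves are trivial at its depth:
their bumps vanish there, so the edge count is unchanged. -/
lemma profile_of_level (h : Sweep D u l S w) {z : ℂ} {k : ℕ} (hz : Level D u l z k)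
    (hpos : z.re = D.pos u (-z.im)) :
    D.profile (fun i => (D.drop i)⁻¹) u (-z.im) = k := by
  induction h with
  | nil u =>
    cases hz with
    | here _ _ hk => rw [D.vertex_im, neg_neg, D.profile_inv_drop u hk]
  | @cons u w i l S hi h ih =>
    cases hz with
    | here _ _ hk => rw [D.vertex_im, neg_neg, D.profile_inv_drop u hk]
    | next hz =>
      have h₁ := D.pos_le_pos_mul_simpleRefl hi (-z.im)
      have h₂ := h.pos_le_of_level hz
      have h₃ : D.pos (u * simpleRefl i) (-z.im) = D.pos u (-z.im) := by linarith
      rw [← ih hz (hpos.trans h₃.symm), D.profile_mul_simpleRefl]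
      rw [D.pos_mul_simpleRefl, add_eq_left] at h₃
      have h₄ := (mul_eq_zero.1 h₃).resolve_left (sub_pos.2 (D.slope_strictMono hi)).ne'
      rw [h₄, mul_zero, add_zero]

/-- Discard paths until one of the two occurrences is on the current path; then both levels equal
the same profile value. -/
lemma level_unique (h : Sweep D u l S w) {z : ℂ} {k k' : ℕ} (hk : Level D u l z k)
    (hk' : Level D u l z k') : k = k' := by
  have key : ∀ {u w : Equiv.Perm (Fin n)} {l S k k'} {z : ℂ}, Sweep D u l S w →
      z.re = D.pos u (-z.im) → Level D u l z k → Level D u l z k' → k = k' := by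
    intro u w l S k k' z h hz hk hk'
    have h₁ := h.profile_of_level hk hz
    rw [h.profile_of_level hk' hz] at h₁
    exact_mod_cast h₁.symm
  have hv : ∀ (u : Equiv.Perm (Fin n)) (k : ℕ),
      (D.vertex u k).re = D.pos u (-(D.vertex u k).im) := by
    intro u k
    rw [D.vertex_im, neg_neg, D.pos_vdrop]
  induction h with
  | nil u =>
    cases hk with
    | here _ _ h₁ => exact key (Sweep.nil _) (hv _ _) (Level.here _ _ h₁) hk'
  | cons hi h ih =>
    cases hk with
    | here _ _ h₁ => exact key (h.cons hi) (hv _ _) (Level.here _ _ h₁) hk'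
    | next hk =>
      cases hk' with
      | here _ _ h₁ => exact key (h.cons hi) (hv _ _) (Level.next hk) (Level.here _ _ h₁)
      | next hk' => exact ih hk hk'

lemma level_last (h : Sweep D u l S w) {k : ℕ} (hk : k ≤ n) : Level D u l (D.vertex w k) k := by
  induction h with
  | nil u => exact Level.here _ _ hk
  | cons hi h ih => exact Level.next ih

lemma level_edge (h : Sweep D u l S w) {t : Tile n} (ht : t ∈ S) {p : ℂ} {i : Fin n}
    (hp : (p, i) ∈ t.edges D) : ∃ k, Level D u l p k ∧ Level D u l (p + D.dir i) (k + 1) := by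
  induction h with
  | nil => simp at ht
  | @cons u w j l S hj h ih =>
    rcases List.mem_cons.1 ht with rfl | ht
    · have h₁ : ∀ k, (p, i) = D.pathEdge u k →
          ∃ k, Level D u (j :: l) p k ∧ Level D u (j :: l) (p + D.dir i) (k + 1) := by
        intro k hk
        obtain ⟨rfl, rfl⟩ := Prod.mk.inj hk
        rw [← D.vertex_succ]
        exact ⟨k, Level.here _ _ k.isLt.le, Level.here _ _ k.isLt⟩
      have h₂ : ∀ k, (p, i) = D.pathEdge (u * simpleRefl j) k →
          ∃ k, Level D u (j :: l) p k ∧ Level D u (j :: l) (p + D.dir i) (k + 1) := by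
        intro k hk
        obtain ⟨rfl, rfl⟩ := Prod.mk.inj hk
        rw [← D.vertex_succ]
        exact ⟨k, Level.next (Level.here _ _ k.isLt.le), Level.next (Level.here _ _ k.isLt)⟩
      rw [edges_tileAt] at hp
      rcases hp with hp | hp | hp | hp
      · exact h₁ _ hp
      · exact h₁ _ hp
      · exact h₂ _ hp
      · exact h₂ _ hp
    · obtain ⟨k, hk₁, hk₂⟩ := ih ht
      exact ⟨k, Level.next hk₁, Level.next hk₂⟩

end Sweep

namespace RhombicTiling

variable {w : Equiv.Perm (Fin n)} {T : RhombicTiling D w} {l : List (Fin (n - 1))}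
  {L : List (Tile n)}

/-- A tile edge joins consecutive levels, so a walk cannot gain more levels than it has edges; this
bounds distances from below. -/
lemma level_of_walk (h : Sweep D 1 l L w) (hL : ∀ t, t ∈ L ↔ t ∈ T.tiles) {p q : ℂ}
    (W : T.graph.Walk p q) {k : ℕ} (hp : Level D 1 l p k) :
    ∃ k', Level D 1 l q k' ∧ k' ≤ k + W.length := by
  induction W generalizing k with
  | nil => exact ⟨k, hp, le_rfl⟩
  | @cons p r q hadj W ih =>
    obtain ⟨k₁, hk₁, hle₁⟩ : ∃ k₁, Level D 1 l r k₁ ∧ k₁ ≤ k + 1 := by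
      rcases (SimpleGraph.fromRel_adj _ _ _).1 hadj with
        ⟨-, ⟨t, ht, i, hpi, rfl⟩ | ⟨t, ht, i, hpi, rfl⟩⟩
      · obtain ⟨m, hm, hm'⟩ := h.level_edge ((hL t).2 ht) hpi
        exact ⟨m + 1, hm', by rw [h.level_unique hm hp]⟩
      · obtain ⟨m, hm, hm'⟩ := h.level_edge ((hL t).2 ht) hpi
        have := h.level_unique hm' hp
        exact ⟨m, hm, by omega⟩
    obtain ⟨k', hk', hle⟩ := ih hk₁
    exact ⟨k', hk', by rw [SimpleGraph.Walk.length_cons]; omega⟩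

lemma edist_vertex_le {v : Equiv.Perm (Fin n)}
    (hv : ∀ j, ∃ t ∈ T.tiles, D.pathEdge v j ∈ t.edges D) {k : ℕ} (hk : k ≤ n) :
    T.graph.edist 0 (D.vertex v k) ≤ k := by
  induction k with
  | zero => simp
  | succ k ih =>
    have hadj : T.graph.Adj (D.vertex v k) (D.vertex v (k + 1)) := by
      refine (SimpleGraph.fromRel_adj _ _ _).2 ⟨fun h => ?_, Or.inl ?_⟩
      · have := D.vertex_inj v (by omega) hk h
        omega
      · obtain ⟨t, ht, hte⟩ := hv ⟨k, hk⟩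
        exact ⟨t, ht, v ⟨k, hk⟩, hte, D.vertex_succ v ⟨k, hk⟩⟩
    refine (SimpleGraph.edist_triangle (v := D.vertex v k)).trans ?_
    rw [SimpleGraph.edist_eq_one_iff_adj.2 hadj, Nat.cast_add, Nat.cast_one]
    exact add_le_add_left (ih (by omega)) 1

lemma le_edist (h : Sweep D 1 l L w) (hL : ∀ t, t ∈ L ↔ t ∈ T.tiles) {z : ℂ} {k : ℕ}
    (hz : Level D 1 l z k) : (k : ℕ∞) ≤ T.graph.edist 0 z := by
  refine le_iInf fun W => ?_
  have h₀ : Level D 1 l 0 0 := by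
    simpa using Level.here (D := D) 1 l (Nat.zero_le n)
  obtain ⟨k', hk', hle⟩ := level_of_walk h hL W h₀
  rw [h.level_unique hz hk']
  exact_mod_cast (by omega : k' ≤ W.length)

lemma edist_leftside (hn : 2 ≤ n) (hw : IsContiguous w) (T : RhombicTiling D w) {k : ℕ}
    (hk : k ≤ n) : T.graph.edist 0 (D.vertex 1 k) = k := by
  obtain ⟨l, L, h, hL⟩ := T.exists_sweep (by omega)
  refine le_antisymm (edist_vertex_le (fun j => ?_) hk) (le_edist h hL (Level.here _ _ hk))
  obtain ⟨t, ht, hte⟩ := (h.exists_edges hn hw j).1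
  exact ⟨t, (hL t).1 ht, hte⟩

lemma edist_rightside (hn : 2 ≤ n) (hw : IsContiguous w) (T : RhombicTiling D w) {k : ℕ}
    (hk : k ≤ n) : T.graph.edist 0 (D.vertex w k) = k := by
  obtain ⟨l, L, h, hL⟩ := T.exists_sweep (by omega)
  refine le_antisymm (edist_vertex_le (fun j => ?_) hk) (le_edist h hL (h.level_last hk))
  obtain ⟨t, ht, hte⟩ := (h.exists_edges hn hw j).2
  exact ⟨t, (hL t).1 ht, hte⟩

end RhombicTiling

end

section

variable {D : Drawing n} {w : Equiv.Perm (Fin n)}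

/-! ### Perimeter tiles and descents -/

lemma exists_leftPerimeter_iff (hn : 2 ≤ n) (hw : IsContiguous w) (i : Fin (n - 1)) :
    (∃ T : RhombicTiling D w, ∃ t ∈ T.tiles, t.IsLeftPerimeter D ∧ T.HasDepth t (i.val + 1)) ↔
      length (simpleRefl i * w) < length w := by
  classical
  constructor
  · rintro ⟨T, t, ht, ⟨j, k, hjk, hj, hk⟩, hd⟩
    have hT := T.tilesBetween (by omega)
    rcases eq_tileAt_of_two_edges hjk hj hk with ⟨m, hm, rfl⟩ | ⟨m, hm, -⟩
    · have hdm : T.graph.edist 0 (D.vertex 1 m.val) = m.val :=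
        RhombicTiling.edist_leftside hn hw T (by omega)
      rw [RhombicTiling.HasDepth, Drawing.tileAt, hdm] at hd
      obtain rfl : m = i := Fin.ext (by
        have : m.val + 1 = i.val + 1 := by exact_mod_cast hd
        omega)
      -- The tiles left after removing this one are swept from `simpleRefl m` to `w`, by a word for
      -- `simpleRefl m * w` one letter shorter than a reduced word of `w`.
      obtain ⟨l, L, h, -⟩ := TilesBetween.exists_sweep _ _ _ rfl (hT.erase_left hm ht)
        (hT.pos_le hm ht fun h _ _ => pos_one_le_pos D w h)
      have h₁ := h.card_inversions
      rw [card_inversions_mul_of_lt hm, inversions_one, Finset.card_empty] at h₁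
      have h₂ : simpleRefl m * w = wordProd l := by
        rw [h.eq_mul, one_mul, ← mul_assoc, simpleRefl_mul_self, one_mul]
      have h₃ := length_wordProd_le l
      rw [h₂, length_eq_card_inversions w]
      omega
    · simp only [Equiv.Perm.mul_apply, Equiv.Perm.one_apply, simpleRefl_loPos,
        simpleRefl_hiPos] at hm
      exact absurd hm (loPos_lt_hiPos m).not_gt
  · intro h
    obtain ⟨⟨l, hl, hk⟩, hi⟩ := (length_simpleRefl_mul_lt_iff w i).1 h
    obtain ⟨S, hS⟩ := Sweep.exists_of_reduced D hl hk
    obtain ⟨T, hT⟩ := hS.exists_tiling hn hw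
    rcases l with _ | ⟨j, l⟩
    · simp at hi
    · obtain rfl := Option.some.inj hi
      obtain _ | ⟨hj, hS⟩ := hS
      refine ⟨T, _, (hT _).2 List.mem_cons_self, ⟨_, _, loPos_ne_hiPos j, ?_, ?_⟩, ?_⟩
      · rw [edges_tileAt]
        exact Or.inl rfl
      · rw [edges_tileAt]
        exact Or.inr (Or.inl rfl)
      · rw [RhombicTiling.HasDepth, Drawing.tileAt, RhombicTiling.edist_leftside hn hw T (by omega)]
        push_cast
        rfl

lemma exists_rightPerimeter_iff (hn : 2 ≤ n) (hw : IsContiguous w) (i : Fin (n - 1)) :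
    (∃ T : RhombicTiling D w, ∃ t ∈ T.tiles, t.IsRightPerimeter D w ∧ T.HasDepth t (i.val + 1)) ↔
      length (w * simpleRefl i) < length w := by
  classical
  constructor
  · rintro ⟨T, t, ht, ⟨j, k, hjk, hj, hk⟩, hd⟩
    have hT := T.tilesBetween (by omega)
    have hdepth : ∀ m : Fin (n - 1), t.top = D.vertex w m.val → m = i := by
      intro m hm
      rw [RhombicTiling.HasDepth, hm, RhombicTiling.edist_rightside hn hw T (by omega)] at hd
      refine Fin.ext ?_
      have : m.val + 1 = i.val + 1 := by exact_mod_cast hd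
      omega
    rcases eq_tileAt_of_two_edges hjk hj hk with ⟨m, hm, rfl⟩ | ⟨m, hm, rfl⟩
    -- A tile with its left boundary on the rightside would stick out of the polygon.
    · exfalso
      have hlt := D.vdrop_lt w (show m.val < m.val + 2 by omega) (by omega)
      obtain ⟨x, hx₁, hx₂⟩ := exists_between hlt
      have h₁ := (D.pos_lt_pos_mul_simpleRefl_iff hm).2 ⟨hx₁, hx₂⟩
      rw [← D.right_tileAt hm hx₁.le hx₂.le] at h₁
      refine (hT.right_le ht ?_ ?_).not_gt h₁
      · rw [D.topDrop_tileAt]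
        exact hx₁.le
      · rw [D.botDrop_tileAt]
        exact hx₂.le
    · obtain rfl := hdepth m (D.vertex_mul_simpleRefl w m (by omega))
      have hT' : TilesBetween D T.tiles (D.pos 1) (D.pos (w * simpleRefl m * simpleRefl m)) := by
        rwa [mul_simpleRefl_cancel]
      obtain ⟨l, L, h, -⟩ := TilesBetween.exists_sweep _ _ _ rfl (hT'.erase_right hm ht)
        fun h _ _ => pos_one_le_pos D _ h
      have h₁ := card_inversions_mul_of_lt hm
      rw [mul_simpleRefl_cancel] at h₁
      rw [length_eq_card_inversions, length_eq_card_inversions, h₁]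
      exact Nat.lt_succ_self _
  · intro h
    obtain ⟨⟨l, hl, hk⟩, hi⟩ := (length_mul_simpleRefl_lt_iff w i).1 h
    obtain ⟨S, hS⟩ := Sweep.exists_of_reduced D hl hk
    obtain ⟨T, hT⟩ := hS.exists_tiling hn hw
    obtain ⟨l', rfl⟩ := List.getLast?_eq_some_iff.1 hi
    obtain ⟨hm, hmem⟩ := hS.exists_last rfl
    have hedges := edges_tileAt (D := D) hm
    rw [mul_simpleRefl_cancel] at hedges
    refine ⟨T, _, (hT _).2 hmem, ⟨_, _, loPos_ne_hiPos i, ?_, ?_⟩, ?_⟩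
    · rw [hedges]
      exact Or.inr (Or.inr (Or.inl rfl))
    · rw [hedges]
      exact Or.inr (Or.inr (Or.inr rfl))
    · rw [RhombicTiling.HasDepth, Drawing.tileAt, D.vertex_mul_simpleRefl w i (by omega),
        RhombicTiling.edist_rightside hn hw T (by omega)]
      push_cast
      rfl

/-! ### Perimeter tiles at the top and bottom vertices -/

lemma IsContiguous.apply_zero_ne (hw : IsContiguous w) (hn : 2 ≤ n) {z : Fin n}
    (hz : z.val = 0) : w z ≠ z := by
  intro h
  have hset : {i : Fin n | i.val < 1} = {z} := by
    ext i
    simp only [Set.mem_ofPred_eq, Set.mem_singleton_iff, Fin.ext_iff]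
    omega
  apply hw 1 one_pos (by omega)
  rw [hset, Set.image_singleton, h]

lemma IsContiguous.apply_last_ne (hw : IsContiguous w) (hn : 2 ≤ n) {z : Fin n}
    (hz : z.val + 1 = n) : w z ≠ z := by
  intro h
  have hset : {i : Fin n | i.val < n - 1} = {z}ᶜ := by
    ext i
    simp only [Set.mem_ofPred_eq, Set.mem_compl_iff, Set.mem_singleton_iff, Fin.ext_iff]
    omega
  apply hw (n - 1) (by omega) (by omega)
  rw [hset, Set.image_compl_eq w.bijective, Set.image_singleton, h]

namespace Sweep

variable {u : Equiv.Perm (Fin n)} {l : List (Fin (n - 1))} {S : List (Tile n)} {i₀ : Fin (n - 1)}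

lemma apply_eq_of_ne_top {i : Fin (n - 1)} (h₀ : i₀.val = 0) (h : i ≠ i₀) :
    (u * simpleRefl i) (loPos i₀) = u (loPos i₀) := by
  rw [Equiv.Perm.mul_apply, simpleRefl_of_ne]
  · exact fun h' => h (Fin.ext (congrArg Fin.val h').symm)
  · intro h'
    have := congrArg Fin.val h'
    simp only [loPos_val, hiPos_val] at this
    omega

lemma apply_eq_of_ne_bottom {i : Fin (n - 1)} (h₀ : i₀.val + 2 = n) (h : i ≠ i₀) :
    (u * simpleRefl i) (hiPos i₀) = u (hiPos i₀) := by
  rw [Equiv.Perm.mul_apply, simpleRefl_of_ne]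
  · intro h'
    have := congrArg Fin.val h'
    simp only [loPos_val, hiPos_val] at this
    omega
  · intro h'
    have := congrArg Fin.val h'
    simp only [hiPos_val] at this
    exact h (Fin.ext (by omega))

lemma top_le (h : Sweep D u l S w) (h₀ : i₀.val = 0) :
    u (loPos i₀) ≤ w (loPos i₀) ∧ (u (loPos i₀) = w (loPos i₀) → l.count i₀ = 0) := by
  induction h with
  | nil => simp
  | @cons u w i l S hi h ih =>
    by_cases hii : i = i₀
    · subst hii
      rw [Equiv.Perm.mul_apply, simpleRefl_loPos] at ih
      have := hi.trans_le ih.1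
      exact ⟨this.le, fun h => absurd h this.ne⟩
    · rw [apply_eq_of_ne_top h₀ hii] at ih
      rwa [List.count_cons_of_ne hii]

lemma bottom_le (h : Sweep D u l S w) (h₀ : i₀.val + 2 = n) :
    w (hiPos i₀) ≤ u (hiPos i₀) ∧ (w (hiPos i₀) = u (hiPos i₀) → l.count i₀ = 0) := by
  induction h with
  | nil => simp
  | @cons u w i l S hi h ih =>
    by_cases hii : i = i₀
    · subst hii
      rw [Equiv.Perm.mul_apply, simpleRefl_hiPos] at ih
      have := ih.1.trans_lt hi
      exact ⟨this.le, fun h => absurd h this.ne⟩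
    · rw [apply_eq_of_ne_bottom h₀ hii] at ih
      rwa [List.count_cons_of_ne hii]

lemma eq_of_topDrop_eq_zero {i : Fin (n - 1)} (hi : u (loPos i) < u (hiPos i)) (h₀ : i₀.val = 0)
    (ht : (D.tileAt u i hi).topDrop = 0) : i = i₀ := by
  rw [D.topDrop_tileAt, ← D.vdrop_zero u] at ht
  have := D.vdrop_inj u (by omega) (by omega) ht
  exact Fin.ext (by omega)

lemma eq_of_botDrop_eq_height {i : Fin (n - 1)} (hi : u (loPos i) < u (hiPos i))
    (h₀ : i₀.val + 2 = n) (ht : (D.tileAt u i hi).botDrop D = D.height) : i = i₀ := by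
  rw [D.botDrop_tileAt, ← D.vdrop_eq_height u] at ht
  have := D.vdrop_inj u (by omega) le_rfl ht
  exact Fin.ext (by omega)

/-- The first label never decreases, and a tile swept at the top vertex has the first label of that
moment as its smaller label. -/
lemma top_le_of_mem (h : Sweep D u l S w) (h₀ : i₀.val = 0) {t : Tile n} (ht : t ∈ S)
    (htop : t.topDrop = 0) : u (loPos i₀) ≤ t.a := by
  induction h with
  | nil => simp at ht
  | @cons u w i l S hi h ih =>
    rcases List.mem_cons.1 ht with rfl | ht
    · rw [← eq_of_topDrop_eq_zero hi h₀ htop]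
      exact le_rfl
    · refine le_trans ?_ (ih ht)
      by_cases hii : i = i₀
      · subst hii
        simpa using hi.le
      · rw [apply_eq_of_ne_top h₀ hii]

lemma le_bottom_of_mem (h : Sweep D u l S w) (h₀ : i₀.val + 2 = n) {t : Tile n} (ht : t ∈ S)
    (hbot : t.botDrop D = D.height) : t.b ≤ u (hiPos i₀) := by
  induction h with
  | nil => simp at ht
  | @cons u w i l S hi h ih =>
    rcases List.mem_cons.1 ht with rfl | ht
    · rw [← eq_of_botDrop_eq_height hi h₀ hbot]
      exact le_rfl
    · refine (ih ht).trans ?_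
      by_cases hii : i = i₀
      · subst hii
        simpa using hi.le
      · rw [apply_eq_of_ne_bottom h₀ hii]

/-- The label `a` forces the tile to be the first one swept at the top, since later ones have larger
smaller labels; the label `b` is then already the final first label, so the letter does not occur
again. -/
lemma count_eq_one_of_top (h : Sweep D u l S w) (h₀ : i₀.val = 0) {t : Tile n} (ht : t ∈ S)
    (htop : t.topDrop = 0) (ha : t.a = u (loPos i₀)) (hb : t.b = w (loPos i₀)) :
    l.count i₀ = 1 := by
  induction h with
  | nil => simp at ht
  | @cons u w i l S hi h ih =>
    by_cases hii : i = i₀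
    · subst hii
      rcases List.mem_cons.1 ht with rfl | ht
      · have := (h.top_le h₀).2 (by simpa [Drawing.tileAt] using hb)
        rw [List.count_cons_self, this]
      · have := h.top_le_of_mem h₀ ht htop
        rw [ha, Equiv.Perm.mul_apply, simpleRefl_loPos] at this
        exact absurd hi this.not_gt
    · rw [List.count_cons_of_ne hii]
      rcases List.mem_cons.1 ht with rfl | ht
      · exact absurd (eq_of_topDrop_eq_zero hi h₀ htop) hii
      · exact ih ht (by rw [apply_eq_of_ne_top h₀ hii, ha]) hb

lemma count_eq_one_of_bottom (h : Sweep D u l S w) (h₀ : i₀.val + 2 = n) {t : Tile n}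
    (ht : t ∈ S) (hbot : t.botDrop D = D.height) (ha : t.a = w (hiPos i₀))
    (hb : t.b = u (hiPos i₀)) : l.count i₀ = 1 := by
  induction h with
  | nil => simp at ht
  | @cons u w i l S hi h ih =>
    by_cases hii : i = i₀
    · subst hii
      rcases List.mem_cons.1 ht with rfl | ht
      · have := (h.bottom_le h₀).2 (by simpa [Drawing.tileAt] using ha.symm)
        rw [List.count_cons_self, this]
      · have := h.le_bottom_of_mem h₀ ht hbot
        rw [hb, Equiv.Perm.mul_apply, simpleRefl_hiPos] at this
        exact absurd hi this.not_gt
    · rw [List.count_cons_of_ne hii]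
      rcases List.mem_cons.1 ht with rfl | ht
      · exact absurd (eq_of_botDrop_eq_height hi h₀ hbot) hii
      · exact ih ht ha (by rw [apply_eq_of_ne_bottom h₀ hii, hb])

lemma pathEdge_eq_of_ne_top {i : Fin (n - 1)} (h₀ : i₀.val = 0) (h : i ≠ i₀) :
    D.pathEdge (u * simpleRefl i) (loPos i₀) = D.pathEdge u (loPos i₀) := by
  rw [Drawing.pathEdge, Drawing.pathEdge, apply_eq_of_ne_top h₀ h, loPos_val, h₀, D.vertex_zero,
    D.vertex_zero]

lemma pathEdge_eq_of_ne_bottom {i : Fin (n - 1)} (h₀ : i₀.val + 2 = n) (h : i ≠ i₀) :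
    D.pathEdge (u * simpleRefl i) (hiPos i₀) = D.pathEdge u (hiPos i₀) := by
  rw [Drawing.pathEdge, Drawing.pathEdge, apply_eq_of_ne_bottom h₀ h, D.vertex_mul_simpleRefl]
  rw [hiPos_val]
  exact fun h' => h (Fin.ext (by omega))

lemma pathEdge_top_eq (h : Sweep D u l S w) (h₀ : i₀.val = 0) (hl : l.count i₀ = 0) :
    D.pathEdge w (loPos i₀) = D.pathEdge u (loPos i₀) := by
  induction h with
  | nil => rfl
  | @cons u w i l S hi h ih =>
    rw [List.count_eq_zero, List.mem_cons, not_or, ← List.count_eq_zero] at hl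
    rw [ih hl.2, pathEdge_eq_of_ne_top h₀ (Ne.symm hl.1)]

lemma pathEdge_bottom_eq (h : Sweep D u l S w) (h₀ : i₀.val + 2 = n) (hl : l.count i₀ = 0) :
    D.pathEdge w (hiPos i₀) = D.pathEdge u (hiPos i₀) := by
  induction h with
  | nil => rfl
  | @cons u w i l S hi h ih =>
    rw [List.count_eq_zero, List.mem_cons, not_or, ← List.count_eq_zero] at hl
    rw [ih hl.2, pathEdge_eq_of_ne_bottom h₀ (Ne.symm hl.1)]

lemma exists_top (h : Sweep D u l S w) (h₀ : i₀.val = 0) (hl : l.count i₀ = 1) :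
    ∃ t ∈ S, D.pathEdge u (loPos i₀) ∈ t.edges D ∧ D.pathEdge w (loPos i₀) ∈ t.edges D := by
  induction h with
  | nil => simp at hl
  | @cons u w i l S hi h ih =>
    by_cases hii : i = i₀
    · subst hii
      rw [List.count_cons_self, Nat.add_eq_right] at hl
      refine ⟨_, List.mem_cons_self, ?_⟩
      rw [h.pathEdge_top_eq h₀ hl, edges_tileAt]
      exact ⟨Or.inl rfl, Or.inr (Or.inr (Or.inl rfl))⟩
    · rw [List.count_cons_of_ne hii] at hl
      obtain ⟨t, ht, h₁, h₂⟩ := ih hl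
      rw [pathEdge_eq_of_ne_top h₀ hii] at h₁
      exact ⟨t, List.mem_cons_of_mem _ ht, h₁, h₂⟩

lemma exists_bottom (h : Sweep D u l S w) (h₀ : i₀.val + 2 = n) (hl : l.count i₀ = 1) :
    ∃ t ∈ S, D.pathEdge u (hiPos i₀) ∈ t.edges D ∧ D.pathEdge w (hiPos i₀) ∈ t.edges D := by
  induction h with
  | nil => simp at hl
  | @cons u w i l S hi h ih =>
    by_cases hii : i = i₀
    · subst hii
      rw [List.count_cons_self, Nat.add_eq_right] at hl
      refine ⟨_, List.mem_cons_self, ?_⟩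
      rw [h.pathEdge_bottom_eq h₀ hl, edges_tileAt]
      exact ⟨Or.inr (Or.inl rfl), Or.inr (Or.inr (Or.inr rfl))⟩
    · rw [List.count_cons_of_ne hii] at hl
      obtain ⟨t, ht, h₁, h₂⟩ := ih hl
      rw [pathEdge_eq_of_ne_bottom h₀ hii] at h₁
      exact ⟨t, List.mem_cons_of_mem _ ht, h₁, h₂⟩

end Sweep

lemma Tile.topDrop_of_mem_edges {t : Tile n} {p : ℂ} {i : Fin n} (h : (p, i) ∈ t.edges D) :
    (i = t.a ∧ (-p.im = t.topDrop ∨ -p.im + D.drop i = t.botDrop D)) ∨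
      (i = t.b ∧ (-p.im = t.topDrop ∨ -p.im + D.drop i = t.botDrop D)) := by
  simp only [Tile.edges, Set.mem_insert_iff, Set.mem_singleton_iff, Prod.mk.injEq] at h
  have hbot : t.botDrop D = -t.top.im + (D.drop t.a + D.drop t.b) := rfl
  rcases h with ⟨rfl, rfl⟩ | ⟨rfl, rfl⟩ | ⟨rfl, rfl⟩ | ⟨rfl, rfl⟩
  · exact Or.inl ⟨rfl, Or.inl rfl⟩
  · refine Or.inr ⟨rfl, Or.inr ?_⟩
    rw [hbot, Complex.add_im, D.dir_im]
    ring
  · exact Or.inr ⟨rfl, Or.inl rfl⟩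
  · refine Or.inl ⟨rfl, Or.inr ?_⟩
    rw [hbot, Complex.add_im, D.dir_im]
    ring

/-- A tile is higher than each of its edges. -/
lemma Tile.topDrop_add_drop_lt_botDrop {t : Tile n} {i : Fin n} (h : i = t.a ∨ i = t.b) :
    t.topDrop + D.drop i < t.botDrop D := by
  have ha := D.drop_pos t.a
  have hb := D.drop_pos t.b
  have hbot : t.botDrop D = t.topDrop + (D.drop t.a + D.drop t.b) := rfl
  rcases h with rfl | rfl <;> linarith

lemma Tile.label_of_mem_edges {t : Tile n} {p : ℂ} {i : Fin n} (h : (p, i) ∈ t.edges D) :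
    i = t.a ∨ i = t.b := by
  rcases Tile.topDrop_of_mem_edges h with h | h
  exacts [Or.inl h.1, Or.inr h.1]

lemma Tile.topDrop_or_botDrop {t : Tile n} {p : ℂ} {i : Fin n} (h : (p, i) ∈ t.edges D) :
    -p.im = t.topDrop ∨ -p.im + D.drop i = t.botDrop D := by
  rcases Tile.topDrop_of_mem_edges h with h | h
  exacts [h.2, h.2]

lemma exists_topPerimeter_iff (hn : 2 ≤ n) (hw : IsContiguous w) {i₀ : Fin (n - 1)}
    (h₀ : i₀.val = 0) :
    (∃ T : RhombicTiling D w, ∃ t ∈ T.tiles, t.IsTopPerimeter D w) ↔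
      ∃ l : ReducedWord w, l.val.count i₀ = 1 := by
  constructor
  · rintro ⟨T, t, ht, k, hk, hL, hR⟩
    obtain rfl : k = loPos i₀ := Fin.ext (by rw [hk, loPos_val, h₀])
    obtain ⟨l, L, h, hmem⟩ := T.exists_sweep (by omega)
    -- If the boundary edge were a lower edge of the tile, the tile would extend above the top
    -- vertex.
    have htop : t.topDrop = 0 := by
      have h₁ := (T.tilesBetween (by omega)).topDrop_nonneg ht
      have h₂ := Tile.topDrop_add_drop_lt_botDrop (D := D) (Tile.label_of_mem_edges hL)
      have h₃ := Tile.topDrop_or_botDrop hL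
      rw [D.vertex_im, neg_neg, loPos_val, h₀, D.vdrop_zero] at h₃
      rcases h₃ with h₃ | h₃ <;> linarith
    have hne := hw.apply_zero_ne hn (z := loPos i₀) h₀
    have hle : loPos i₀ ≤ t.a := Fin.le_def.2 (by rw [loPos_val, h₀]; exact Nat.zero_le _)
    -- The least label cannot be the larger one of a tile; contiguity makes `w` move it, so the
    -- rightside edge carries the other label.
    have ha : loPos i₀ = t.a :=
      (Tile.label_of_mem_edges hL).resolve_right fun hb => (hle.trans_lt t.lt).ne hb
    have hb : w (loPos i₀) = t.b :=
      (Tile.label_of_mem_edges hR).resolve_left fun h' => hne (h'.trans ha.symm)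
    exact ⟨⟨l, h.reduced⟩, h.count_eq_one_of_top h₀ ((hmem t).2 ht) htop ha.symm hb.symm⟩
  · rintro ⟨⟨l, hl, hk⟩, hc⟩
    obtain ⟨S, hS⟩ := Sweep.exists_of_reduced D hl hk
    obtain ⟨T, hT⟩ := hS.exists_tiling hn hw
    obtain ⟨t, ht, h₁, h₂⟩ := hS.exists_top h₀ hc
    exact ⟨T, t, (hT t).2 ht, loPos i₀, h₀, h₁, h₂⟩

lemma exists_bottomPerimeter_iff (hn : 2 ≤ n) (hw : IsContiguous w) {i₀ : Fin (n - 1)}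
    (h₀ : i₀.val + 2 = n) :
    (∃ T : RhombicTiling D w, ∃ t ∈ T.tiles, t.IsBottomPerimeter D w) ↔
      ∃ l : ReducedWord w, l.val.count i₀ = 1 := by
  have hval : (hiPos i₀).val + 1 = n := by rw [hiPos_val]; omega
  constructor
  · rintro ⟨T, t, ht, k, hk, hL, hR⟩
    obtain rfl : k = hiPos i₀ := Fin.ext (by omega)
    obtain ⟨l, L, h, hmem⟩ := T.exists_sweep (by omega)
    have hbot : t.botDrop D = D.height := by
      have h₁ := (T.tilesBetween (by omega)).botDrop_le ht
      have h₂ := Tile.topDrop_add_drop_lt_botDrop (D := D) (Tile.label_of_mem_edges hL)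
      have h₃ := Tile.topDrop_or_botDrop hL
      have h₄ := D.vdrop_succ 1 (hiPos i₀)
      rw [hval, D.vdrop_eq_height] at h₄
      rw [D.vertex_im, neg_neg] at h₃
      rcases h₃ with h₃ | h₃ <;> linarith
    have hne := hw.apply_last_ne hn hval
    have hle : t.b ≤ hiPos i₀ := Fin.le_def.2 (by omega)
    have hb : hiPos i₀ = t.b :=
      (Tile.label_of_mem_edges hL).resolve_left fun ha => (t.lt.trans_le hle).ne' ha
    have ha : w (hiPos i₀) = t.a :=
      (Tile.label_of_mem_edges hR).resolve_right fun h' => hne (h'.trans hb.symm)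
    exact ⟨⟨l, h.reduced⟩, h.count_eq_one_of_bottom h₀ ((hmem t).2 ht) hbot ha.symm hb.symm⟩
  · rintro ⟨⟨l, hl, hk⟩, hc⟩
    obtain ⟨S, hS⟩ := Sweep.exists_of_reduced D hl hk
    obtain ⟨T, hT⟩ := hS.exists_tiling hn hw
    obtain ⟨t, ht, h₁, h₂⟩ := hS.exists_bottom h₀ hc
    exact ⟨T, t, (hT t).2 ht, hiPos i₀, hval, h₁, h₂⟩

end

end Elnitsky

theorem mainTheorem6 (n : ℕ) (hn : 2 ≤ n) (w : Equiv.Perm (Fin n))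
    (hw : Elnitsky.IsContiguous w) (D : Elnitsky.Drawing n) :
    (∀ i : Fin (n - 1),
      ((∃ T : Elnitsky.RhombicTiling D w, ∃ t ∈ T.tiles,
          t.IsLeftPerimeter D ∧ T.HasDepth t (i.val + 1)) ↔
        Elnitsky.length (Elnitsky.simpleRefl i * w) < Elnitsky.length w) ∧
      (Elnitsky.length (Elnitsky.simpleRefl i * w) < Elnitsky.length w ↔
        ∃ l : Elnitsky.ReducedWord w, l.val.head? = some i)) ∧
    (∀ i : Fin (n - 1),
      ((∃ T : Elnitsky.RhombicTiling D w, ∃ t ∈ T.tiles,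
          t.IsRightPerimeter D w ∧ T.HasDepth t (i.val + 1)) ↔
        Elnitsky.length (w * Elnitsky.simpleRefl i) < Elnitsky.length w) ∧
      (Elnitsky.length (w * Elnitsky.simpleRefl i) < Elnitsky.length w ↔
        ∃ l : Elnitsky.ReducedWord w, l.val.getLast? = some i)) ∧
    ((∃ T : Elnitsky.RhombicTiling D w, ∃ t ∈ T.tiles, t.IsTopPerimeter D w) ↔
      ∃ C : Elnitsky.CommClass w, ∀ l : Elnitsky.ReducedWord w, l.MemClass C →
        l.val.count (⟨0, by omega⟩ : Fin (n - 1)) = 1) ∧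
    ((∃ T : Elnitsky.RhombicTiling D w, ∃ t ∈ T.tiles, t.IsBottomPerimeter D w) ↔
      ∃ C : Elnitsky.CommClass w, ∀ l : Elnitsky.ReducedWord w, l.MemClass C →
        l.val.count (⟨n - 2, by omega⟩ : Fin (n - 1)) = 1) := by
  refine ⟨fun i => ⟨?_, ?_⟩, fun i => ⟨?_, ?_⟩, ?_, ?_⟩
  · exact Elnitsky.exists_leftPerimeter_iff hn hw i
  · exact Elnitsky.length_simpleRefl_mul_lt_iff w i
  · exact Elnitsky.exists_rightPerimeter_iff hn hw i
  · exact Elnitsky.length_mul_simpleRefl_lt_iff w i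
  · rw [Elnitsky.exists_topPerimeter_iff hn hw (i₀ := ⟨0, by omega⟩) rfl]
    exact (Elnitsky.exists_commClass_count_iff w _ 1).symm
  · rw [Elnitsky.exists_bottomPerimeter_iff hn hw (i₀ := ⟨n - 2, by omega⟩)
      (Nat.sub_add_cancel hn)]
    exact (Elnitsky.exists_commClass_count_iff w _ 1).symm
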